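/- Let $n,k\ge 0$, let $M$ be a smooth $n$-manifold (without boundary) and let $F$ be a closed smooth $k$-form on $M$, i.e. $dF=0$. For a smooth immersion $f\colon S^k\to M$ and an orientation $o$ of $S^k$, the magnetic charge (represented by $F$) contained in the immersed oriented sphere $(f,o)$ is $$Q_m(f,o):=\int_{(S^k,o)} f^*F .$$ Let $\Sigma$ be a compact oriented smooth $(k+1)$-dimensional manifold with boundary, let $g\colon\Sigma\to M$ be a smooth immersion, and give $\partial\Sigma$ the induced boundary orientation (outward vector first). (1) If $\partial\Sigma=(S^k,o)$ as an oriented manifold, that is, if there is an orientation-preserving diffeomorphism $j\colon (S^k,o)\to\partial\Sigma$, and if $f=g\circ j$ is the resulting immersed sphere, then $Q_m(f,o)=0$. (2) If $\partial\Sigma=(S^k,o)\sqcup(S^k,-o')$ as an oriented manifold, that is, if there are smooth embeddings $j,j'\colon S^k\to\Sigma$ with disjoint images whose union is $\partial\Sigma$, where $j$ is orientation-preserving for $o$ and $j'$ is orientation-preserving for $-o'$ (as maps to $\partial\Sigma$), and if $f=g\circ j$ and $f'=g\circ j'$ are the resulting immersed spheres, then $Q_m(f,o)=Q_m(f',o')$.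 (An oriented manifold of dimension $0$ is a discrete set of points with signs; for $k=0$ the integral of the function $F$ is the corresponding signed sum of its values.) -/

import Mathlib

open Set Module MeasureTheory
open scoped Manifold ContDiff Topology

noncomputable section

/-! ### Differential forms on manifolds -/

section Forms

variable {E : Type*} [NormedAddCommGroup E] [NormedSpace ℝ E]
  {H : Type*} [TopologicalSpace H] (I : ModelWithCorners ℝ E H)
  {E' : Type*} [NormedAddCommGroup E'] [NormedSpace ℝ E']
  {H' : Type*} [TopologicalSpace H'] (J : ModelWithCorners ℝ E' H')
  {M : Type*} [TopologicalSpace M] [ChartedSpace H M]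
  {N : Type*} [TopologicalSpace N] [ChartedSpace H' N]

variable (M) in
/-- A (not necessarily smooth) differential `k`-form on a manifold: an alternating `k`-linear form
on each tangent space. -/
abbrev DiffForm (k : ℕ) : Type _ := (x : M) → TangentSpace I x [⋀^Fin k]→L[ℝ] ℝ

namespace DiffForm

variable {I} {k : ℕ}

/-- The coordinate expression of `α` in the preferred chart at `x₀`, that is, the pullback of `α`
along the inverse of this chart; it is meaningful on the target of the chart. -/
def inChart (α : DiffForm I M k) (x₀ : M) (y : E) : E [⋀^Fin k]→L[ℝ] ℝ :=
  (α ((extChartAt I x₀).symm y)).compContinuousLinearMap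
    (mfderivWithin 𝓘(ℝ, E) I (extChartAt I x₀).symm (range I) y)

/-- A form is smooth if all its coordinate expressions are smooth. -/
def IsSmooth (α : DiffForm I M k) : Prop :=
  ∀ x₀ : M, ContDiffOn ℝ ∞ (α.inChart x₀) (extChartAt I x₀).target

/-- The exterior derivative: at `x`, it is computed in the preferred chart at `x`, and transported
back to the tangent space at `x` by the derivative of this chart. -/
def extDer (α : DiffForm I M k) : DiffForm I M (k + 1) := fun x =>
  (extDerivWithin (α.inChart x) (range I) (extChartAt I x x)).compContinuousLinearMap
    (mfderiv I 𝓘(ℝ, E) (extChartAt I x) x)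

/-- A closed form: a smooth form with vanishing exterior derivative. -/
structure IsClosed (α : DiffForm I M k) : Prop where
  smooth : α.IsSmooth
  extDer_eq_zero : α.extDer = 0

variable {J} in
/-- The pullback of a form along a map. -/
def pullback (f : N → M) (α : DiffForm I M k) : DiffForm J N k := fun x =>
  (α (f x)).compContinuousLinearMap (mfderiv J I f x)

end DiffForm

end Forms

/-! ### Orientations -/

/-- `v` is a positively oriented basis of `V`. For `m = 0` the empty family is positive or not
according to the sign `o`. -/
def IsPositiveFrame {V : Type*} [AddCommGroup V] [Module ℝ V] {m : ℕ}
    (o : Orientation ℝ V (Fin m)) (v : Fin m → V) : Prop :=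
  ∃ b : Basis (Fin m) ℝ V, ⇑b = v ∧ b.orientation = o

theorem isPositiveFrame_basis {V : Type*} [AddCommGroup V] [Module ℝ V] {m : ℕ}
    (o : Orientation ℝ V (Fin m)) (b : Basis (Fin m) ℝ V) :
    IsPositiveFrame o b ↔ b.orientation = o := by
  constructor
  · rintro ⟨b', h, h'⟩
    rwa [← DFunLike.coe_injective h]
  · exact fun h => ⟨b, rfl, h⟩

theorem isPositiveFrame_neg_basis {V : Type*} [AddCommGroup V] [Module ℝ V] {m : ℕ}
    (o : Orientation ℝ V (Fin m)) (b : Basis (Fin m) ℝ V) :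
    IsPositiveFrame (-o) b ↔ ¬ IsPositiveFrame o b := by
  rw [isPositiveFrame_basis, isPositiveFrame_basis]
  have h := b.orientation_ne_iff_eq_neg o
  have hn : ∀ p : Orientation ℝ V (Fin m), -(-p) = p := fun p => neg_neg (G := Module.Ray ℝ _) p
  constructor
  · intro h1 h2
    exact h.2 (by rw [h1, hn]) h2.symm
  · intro h1
    rw [h.1 (fun h2 => h1 h2.symm), hn]

section Orientations

variable {m : ℕ} {H : Type*} [TopologicalSpace H]
  (I : ModelWithCorners ℝ (EuclideanSpace ℝ (Fin m)) H)
  (N : Type*) [TopologicalSpace N] [ChartedSpace H N]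

variable {N} in
/-- The coordinate frame of the preferred chart at `x₀`, at the point with coordinates `y`. -/
def chartFrame (x₀ : N) (y : EuclideanSpace ℝ (Fin m)) :
    Fin m → TangentSpace I ((extChartAt I x₀).symm y) := fun i =>
  mfderivWithin 𝓘(ℝ, EuclideanSpace ℝ (Fin m)) I (extChartAt I x₀).symm (range I) y
    (EuclideanSpace.single i (1 : ℝ) : EuclideanSpace ℝ (Fin m))

/-- An orientation of an `m`-dimensional manifold (possibly with boundary): a choice of orientation
of each tangent space which is locally constant, in that in each chart the coordinate
frame is locally either everywhere positive or everywhere not positive. -/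
@[ext]
structure ManifoldOrientation where
  toFun : (x : N) → Orientation ℝ (TangentSpace I x) (Fin m)
  locallyConstant : ∀ x₀ : N, ∀ y₀ ∈ (extChartAt I x₀).target,
    ∀ᶠ y in 𝓝[(extChartAt I x₀).target] y₀,
      (IsPositiveFrame (toFun ((extChartAt I x₀).symm y)) (chartFrame I x₀ y) ↔
        IsPositiveFrame (toFun ((extChartAt I x₀).symm y₀)) (chartFrame I x₀ y₀))

variable {I N}

theorem exists_basis_eq_chartFrame [IsManifold I 1 N] {x₀ : N} {y : EuclideanSpace ℝ (Fin m)}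
    (hy : y ∈ (extChartAt I x₀).target) :
    ∃ b : Basis (Fin m) ℝ (TangentSpace I ((extChartAt I x₀).symm y)), ⇑b = chartFrame I x₀ y := by
  obtain ⟨e, he⟩ := isInvertible_mfderivWithin_extChartAt_symm (I := I) hy
  let b : Basis (Fin m) ℝ (TangentSpace 𝓘(ℝ, EuclideanSpace ℝ (Fin m)) y) :=
    (EuclideanSpace.basisFun (Fin m) ℝ).toBasis
  have hb : ∀ i, b i = (EuclideanSpace.single i (1 : ℝ) : EuclideanSpace ℝ (Fin m)) := fun i => by
    change (EuclideanSpace.basisFun (Fin m) ℝ).toBasis i = _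
    rw [OrthonormalBasis.coe_toBasis, EuclideanSpace.basisFun_apply]
  refine ⟨b.map e.toLinearEquiv, ?_⟩
  funext i
  rw [Basis.map_apply, hb]
  simp only [chartFrame, ← he]
  rfl

/-- The opposite orientation. -/
instance [IsManifold I 1 N] : Neg (ManifoldOrientation I N) where
  neg o :=
    { toFun := fun x => -(o.toFun x)
      locallyConstant := by
        intro x₀ y₀ hy₀
        filter_upwards [o.locallyConstant x₀ y₀ hy₀, self_mem_nhdsWithin] with y h hy
        obtain ⟨b, hb⟩ := exists_basis_eq_chartFrame (I := I) hy
        obtain ⟨b₀, hb₀⟩ := exists_basis_eq_chartFrame (I := I) hy₀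
        rw [← hb, ← hb₀] at h ⊢
        rw [isPositiveFrame_neg_basis, isPositiveFrame_neg_basis, h] }

/-! ### Integration of top-degree forms -/

open Classical in
/-- The value of the density `⟨α, o⟩` on a frame `v` of an oriented vector space. -/
def orientedValue {V : Type*} [AddCommGroup V] [Module ℝ V] [TopologicalSpace V]
    (o : Orientation ℝ V (Fin m)) (α : V [⋀^Fin m]→L[ℝ] ℝ) (v : Fin m → V) : ℝ :=
  if IsPositiveFrame o v then α v else -α v

variable (I N) in
/-- A smooth partition of unity subordinate to the sources of the preferred charts. -/
def chartPartition [IsManifold I ∞ N] [T2Space N] [CompactSpace N] :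
    SmoothPartitionOfUnity N I N univ :=
  (SmoothPartitionOfUnity.exists_isSubordinate_chartAt_source I N).choose

/-- The integral of an `m`-form over a compact oriented `m`-manifold: the sum over the charts of the integrals, in coordinates, of the pieces of the form which are cut out by a
partition of unity. -/
def integralForm [IsManifold I ∞ N] [T2Space N] [CompactSpace N]
    (o : ManifoldOrientation I N) (α : DiffForm I N m) : ℝ :=
  ∑ᶠ x₀ : N, ∫ y in (extChartAt I x₀).target,
    chartPartition I N x₀ ((extChartAt I x₀).symm y) *
      orientedValue (o.toFun ((extChartAt I x₀).symm y)) (α ((extChartAt I x₀).symm y))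
        (chartFrame I x₀ y)

end Orientations

/-! ### The boundary orientation -/

section Boundary

variable {k : ℕ} {W : Type*} [TopologicalSpace W] [ChartedSpace (EuclideanHalfSpace (k + 1)) W]
  {N : Type*} [TopologicalSpace N] [ChartedSpace (EuclideanSpace ℝ (Fin k)) N]

/-- A tangent vector at a boundary point points strictly outward if, in a chart with
values in the half space `{y | 0 ≤ y 0}`, its `0`-th component is negative. -/
def IsOutward (p : W) (ν : TangentSpace (𝓡∂ (k + 1)) p) : Prop :=
  (show EuclideanSpace ℝ (Fin (k + 1)) from
    mfderiv (𝓡∂ (k + 1)) 𝓘(ℝ, EuclideanSpace ℝ (Fin (k + 1)))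
      (extChartAt (𝓡∂ (k + 1)) p) p ν) 0 < 0

/-- The boundary of the oriented manifold `W` is the disjoint union of the oriented manifolds
`(N, oN i)`, embedded by the maps `j i`, where the boundary carries the orientation given by the
convention "outward vector first". -/
structure IsOrientedBoundary {ι : Type*} (oW : ManifoldOrientation (𝓡∂ (k + 1)) W)
    (oN : ι → ManifoldOrientation (𝓡 k) N) (j : ι → N → W) : Prop where
  isSmoothEmbedding : ∀ i, Manifold.IsSmoothEmbedding (𝓡 k) (𝓡∂ (k + 1)) ∞ (j i)
  disjoint : Pairwise fun i i' => Disjoint (range (j i)) (range (j i'))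
  iUnion_range : ⋃ i, range (j i) = (𝓡∂ (k + 1)).boundary W
  orientation : ∀ i (x : N) (ν : TangentSpace (𝓡∂ (k + 1)) (j i x)), IsOutward (j i x) ν →
    ∀ v : Fin k → TangentSpace (𝓡 k) x,
      IsPositiveFrame ((oN i).toFun x) v ↔
        IsPositiveFrame (oW.toFun (j i x))
          (Fin.cons ν fun a => mfderiv (𝓡 k) (𝓡∂ (k + 1)) (j i) x (v a) :
            Fin (k + 1) → TangentSpace (𝓡∂ (k + 1)) (j i x))

end Boundary

/-! ### Magnetic charge -/

/-- The standard sphere of dimension `k`. -/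
abbrev StdSphere (k : ℕ) : Type :=
  Metric.sphere (0 : EuclideanSpace ℝ (Fin (k + 1))) 1

/-- The magnetic charge, represented by `F`, contained in the immersed sphere `f` with
orientation `o`. -/
def magneticCharge {n k : ℕ} {M : Type*} [TopologicalSpace M]
    [ChartedSpace (EuclideanSpace ℝ (Fin n)) M] (F : DiffForm (𝓡 n) M k)
    (o : ManifoldOrientation (𝓡 k) (StdSphere k)) (f : StdSphere k → M) : ℝ :=
  integralForm o (F.pullback f)

end

/-! The form `η = g^*F` is closed on `W`, so both claims follow from Stokes' theorem: the integrals
of `η` over the components of the oriented boundary add up to zero. With one component this is (1).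
With two, reversing `-o'` changes the sign of the second integral (`integralForm_neg`), which gives
(2).

Stokes for a closed `η` (`sum_integralForm_boundary_eq_zero`): let `χ_a` be a partition of unity
subordinate to charts of `W`. Since `dη = 0`, `d(χ_a η) = dχ_a ∧ η`, and these forms sum to `d1 ∧ η
= 0`. Hence their integrals sum to zero, once integrals are known not to depend on the chart
(`chartIntegral_eq_of_support`, `sum_chartIntegral_eq_zero`). On the other hand `χ_a η` is compactly
supported in one chart, where the divergence theorem on a box turns the integral of `dχ_a ∧ η` into
minus an integral over the hyperplane `y 0 = 0` (`integral_extDeriv_halfSpace`,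
`chartIntegral_dWedge_eq`). A change of variables identifies the hyperplane integrals with pieces of
the integrals over the boundary spheres (`chartIntegral_boundary`). The minus sign there comes from
the outward vector `-∂₀` in "outward vector first" (`chartSign_mul_det_boundary`), and the two signs
agree.

Orientations enter only as a locally constant factor ±1, which makes densities transform by `|det|`,
as Lebesgue integrals do. Continuity up to the boundary and closedness at interior points suffice,
because the hyperplane is a null set. The case `k = 0` needs no separate treatment. -/

/-! ### Signs of frames and top-degree forms. -/

section FrameSign

variable {V : Type*} [AddCommGroup V] [Module ℝ V] {m : ℕ}

open Classical in
/-- The sign of a frame with respect to an orientation: `1` if it is a positive frame. -/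
noncomputable def frameSign (o : Orientation ℝ V (Fin m)) (v : Fin m → V) : ℝ :=
  if IsPositiveFrame o v then 1 else -1

theorem frameSign_congr {V' : Type*} [AddCommGroup V'] [Module ℝ V'] {m' : ℕ}
    {o : Orientation ℝ V (Fin m)} {v : Fin m → V} {o' : Orientation ℝ V' (Fin m')}
    {v' : Fin m' → V'} (h : IsPositiveFrame o v ↔ IsPositiveFrame o' v') :
    frameSign o v = frameSign o' v' := by
  unfold frameSign
  by_cases h' : IsPositiveFrame o' v' <;> simp [h, h']

theorem orientedValue_eq_frameSign_mul [TopologicalSpace V] (o : Orientation ℝ V (Fin m))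
    (α : V [⋀^Fin m]→L[ℝ] ℝ) (v : Fin m → V) :
    orientedValue o α v = frameSign o v * α v := by
  unfold orientedValue frameSign; split_ifs <;> simp

theorem frameSign_neg_basis (o : Orientation ℝ V (Fin m)) (b : Basis (Fin m) ℝ V) :
    frameSign (-o) b = -frameSign o b := by
  have h := isPositiveFrame_neg_basis o b
  unfold frameSign
  by_cases h' : IsPositiveFrame o b <;> simp [h, h']

theorem isPositiveFrame_iff_det_pos (o : Orientation ℝ V (Fin m)) (b : Basis (Fin m) ℝ V)
    {v : Fin m → V} (hv : 0 < b.det v) : IsPositiveFrame o v ↔ IsPositiveFrame o b := by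
  obtain ⟨hli, hsp⟩ := b.is_basis_iff_det.2 hv.ne'.isUnit
  have hc : v = ⇑(Basis.mk hli hsp.ge) := by simp
  have h2 := (b.orientation_eq_iff_det_pos (Basis.mk hli hsp.ge)).2 (by rwa [← hc])
  conv_lhs => rw [hc]
  rw [isPositiveFrame_basis, isPositiveFrame_basis, h2]

theorem isPositiveFrame_iff_det_neg (o : Orientation ℝ V (Fin m)) (b : Basis (Fin m) ℝ V)
    {v : Fin m → V} (hv : b.det v < 0) : IsPositiveFrame o v ↔ ¬ IsPositiveFrame o b := by
  obtain ⟨hli, hsp⟩ := b.is_basis_iff_det.2 hv.ne.isUnit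
  have hc : v = ⇑(Basis.mk hli hsp.ge) := by simp
  have h2 : (Basis.mk hli hsp.ge).orientation ≠ b.orientation := fun h => by
    have := (b.orientation_eq_iff_det_pos (Basis.mk hli hsp.ge)).1 h.symm
    rw [← hc] at this
    exact lt_asymm hv this
  have h3 := (b.orientation_ne_iff_eq_neg _).1 h2
  conv_lhs => rw [hc]
  rw [← isPositiveFrame_neg_basis, isPositiveFrame_basis, isPositiveFrame_basis, h3]
  have hn : ∀ p : Orientation ℝ V (Fin m), -(-p) = p := fun p => neg_neg (G := Module.Ray ℝ _) p
  constructor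
  · intro h; rw [← h, hn]
  · intro h; rw [h, hn]

/-- A negative determinant flips the sign and a positive one keeps it. If `v` is not a basis, its
default sign `-1` is harmless because the determinant is zero. -/
theorem frameSign_mul_det (o : Orientation ℝ V (Fin m)) (b : Basis (Fin m) ℝ V) (v : Fin m → V) :
    frameSign o v * b.det v = frameSign o b * |b.det v| := by
  rcases lt_trichotomy (b.det v) 0 with h | h | h
  · have := isPositiveFrame_iff_det_neg o b h
    rw [abs_of_neg h]
    by_cases h' : IsPositiveFrame o b <;> simp [frameSign, this, h']
  · simp [h]
  · rw [abs_of_pos h, frameSign_congr (isPositiveFrame_iff_det_pos o b h)]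

/-- A top-degree form is a multiple of `b.det`, and the orientation sign turns `det` into `|det|`.
This is the factor in the change of variables formula. -/
theorem orientedValue_eq_abs_det_mul [TopologicalSpace V] (o : Orientation ℝ V (Fin m))
    (α : V [⋀^Fin m]→L[ℝ] ℝ) (b : Basis (Fin m) ℝ V) (v : Fin m → V) :
    orientedValue o α v = |b.det v| * orientedValue o α b := by
  have h : α v = α b * b.det v := by
    have := DFunLike.congr_fun (AlternatingMap.eq_smul_basis_det b α.toAlternatingMap) v
    simpa using this
  rw [orientedValue_eq_frameSign_mul, orientedValue_eq_frameSign_mul, h, mul_left_comm,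
    frameSign_mul_det]
  ring

end FrameSign

/-! ### Pullbacks in coordinates. -/

section Charts

variable {E : Type*} [NormedAddCommGroup E] [NormedSpace ℝ E]
  {H : Type*} [TopologicalSpace H] (I : ModelWithCorners ℝ E H)
  {E' : Type*} [NormedAddCommGroup E'] [NormedSpace ℝ E']
  {H' : Type*} [TopologicalSpace H'] (J : ModelWithCorners ℝ E' H')
  {M : Type*} [TopologicalSpace M] [ChartedSpace H M]
  {N : Type*} [TopologicalSpace N] [ChartedSpace H' N]

/-- The derivative of the inverse of the preferred chart at `x₀`, at the point with coordinates
`y`, as an endomorphism of the model space. -/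
noncomputable def chartSymmDeriv (x₀ : M) (y : E) : E →L[ℝ] E :=
  mfderivWithin 𝓘(ℝ, E) I (extChartAt I x₀).symm (range I) y

/-- The derivative of `f` at `x`, as a map between the model spaces. -/
noncomputable def mfderivModel (f : N → M) (x : N) : E' →L[ℝ] E := mfderiv J I f x

/-- The expression of `f` in the preferred charts at `x₀` and `m₀`. -/
noncomputable def inCharts (x₀ : N) (m₀ : M) (f : N → M) (y : E') : E :=
  extChartAt I m₀ (f ((extChartAt J x₀).symm y))

variable {I J}

theorem DiffForm.inChart_apply {k : ℕ} (α : DiffForm I M k) (x₀ : M) (y : E) (v : Fin k → E) :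
    α.inChart x₀ y v = (show E [⋀^Fin k]→L[ℝ] ℝ from α ((extChartAt I x₀).symm y))
      fun i => chartSymmDeriv I x₀ y (v i) := rfl

/-- Chain rule for `φ ∘ f ∘ ψ⁻¹`, followed by cancellation of the derivatives of `φ⁻¹` and `φ`.
Derivatives are taken within `range J` so that boundary points are covered. -/
theorem chartSymmDeriv_comp_fderivWithin [IsManifold I 1 M] [IsManifold J 1 N] {f : N → M}
    {x₀ : N} {m₀ : M} {y : E'} (hy : y ∈ (extChartAt J x₀).target)
    (hfy : f ((extChartAt J x₀).symm y) ∈ (extChartAt I m₀).source)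
    (hf : MDifferentiableAt J I f ((extChartAt J x₀).symm y)) :
    (chartSymmDeriv I m₀ (inCharts I J x₀ m₀ f y)).comp
        (fderivWithin ℝ (inCharts I J x₀ m₀ f) (range J) y) =
      (mfderivModel I J f ((extChartAt J x₀).symm y)).comp (chartSymmDeriv J x₀ y) := by
  have U : UniqueMDiffWithinAt 𝓘(ℝ, E') (range J) y :=
    J.uniqueMDiffOn _ (extChartAt_target_subset_range x₀ hy)
  have h1 := mdifferentiableWithinAt_extChartAt_symm (I := J) hy
  have hfy' : f ((extChartAt J x₀).symm y) ∈ (chartAt H m₀).source := by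
    rwa [← extChartAt_source (I := I)]
  have h2 := mdifferentiableAt_extChartAt (I := I) hfy'
  have e : fderivWithin ℝ (inCharts I J x₀ m₀ f) (range J) y =
      (mfderivModel 𝓘(ℝ, E) I (extChartAt I m₀) (f ((extChartAt J x₀).symm y))).comp
        ((mfderivModel I J f ((extChartAt J x₀).symm y)).comp (chartSymmDeriv J x₀ y)) := by
    rw [← mfderivWithin_eq_fderivWithin]
    have e1 := mfderiv_comp_mfderivWithin y hf h1 U
    have e2 := mfderiv_comp_mfderivWithin (g := extChartAt I m₀) (I' := I) (I'' := 𝓘(ℝ, E))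
      (f := f ∘ (extChartAt J x₀).symm) y h2
      (hf.comp_mdifferentiableWithinAt y h1) U
    refine e2.trans ?_
    rw [e1]
    rfl
  rw [e, ← ContinuousLinearMap.comp_assoc]
  have h3 := mfderivWithin_extChartAt_symm_comp_mfderiv_extChartAt' (I := I) hfy
  refine Eq.trans ?_ (ContinuousLinearMap.id_comp _)
  congr 1

theorem DiffForm.inChart_pullback [IsManifold I 1 M] [IsManifold J 1 N] {k : ℕ}
    (α : DiffForm I M k) {f : N → M} {x₀ : N} {m₀ : M} {y : E'}
    (hy : y ∈ (extChartAt J x₀).target)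
    (hfy : f ((extChartAt J x₀).symm y) ∈ (extChartAt I m₀).source)
    (hf : MDifferentiableAt J I f ((extChartAt J x₀).symm y)) :
    (α.pullback f : DiffForm J N k).inChart x₀ y =
      (α.inChart m₀ (inCharts I J x₀ m₀ f y)).compContinuousLinearMap
        (fderivWithin ℝ (inCharts I J x₀ m₀ f) (range J) y) := by
  have h := chartSymmDeriv_comp_fderivWithin hy hfy hf
  have h' : (extChartAt I m₀).symm (inCharts I J x₀ m₀ f y) = f ((extChartAt J x₀).symm y) :=
    (extChartAt I m₀).left_inv hfy
  ext v
  have hv := fun i => DFunLike.congr_fun h (v i)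
  simp only [ContinuousLinearMap.comp_apply] at hv
  -- Every tangent space is the model space by definition; forgetting the dependence on the base
  -- point allows rewriting along `h'`.
  let α' : M → E [⋀^Fin k]→L[ℝ] ℝ := α
  change α' (f ((extChartAt J x₀).symm y)) (fun i => mfderiv J I f ((extChartAt J x₀).symm y)
    (chartSymmDeriv J x₀ y (v i))) = α' ((extChartAt I m₀).symm (inCharts I J x₀ m₀ f y))
    (fun i => chartSymmDeriv I m₀ (inCharts I J x₀ m₀ f y)
      (fderivWithin ℝ (inCharts I J x₀ m₀ f) (range J) y (v i)))
  rw [h']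
  exact congrArg _ (funext fun i => (hv i).symm)

theorem contDiffWithinAt_inCharts [IsManifold I ∞ M] [IsManifold J ∞ N] {f : N → M}
    (hf : ContMDiff J I ∞ f) {x₀ : N} {m₀ : M} {y : E'} (hy : y ∈ (extChartAt J x₀).target)
    (hfy : f ((extChartAt J x₀).symm y) ∈ (extChartAt I m₀).source) :
    ContDiffWithinAt ℝ ∞ (inCharts I J x₀ m₀ f) (range J) y := by
  rw [← contMDiffWithinAt_iff_contDiffWithinAt]
  have h1 : ContMDiffWithinAt 𝓘(ℝ, E') J ∞ (extChartAt J x₀).symm (range J) y :=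
    contMDiffWithinAt_extChartAt_symm_range x₀ hy
  have h2 : ContMDiffAt I 𝓘(ℝ, E) ∞ (extChartAt I m₀) (f ((extChartAt J x₀).symm y)) :=
    contMDiffAt_extChartAt' (by rwa [← extChartAt_source (I := I)])
  exact h2.comp_contMDiffWithinAt y ((hf _).comp_contMDiffWithinAt y h1)

theorem eventually_mem_source_inCharts {f : N → M}
    (hf : Continuous f) {x₀ : N} {m₀ : M} {y : E'} (hy : y ∈ (extChartAt J x₀).target)
    (hfy : f ((extChartAt J x₀).symm y) ∈ (extChartAt I m₀).source) :
    ∀ᶠ z in 𝓝[range J] y, z ∈ (extChartAt J x₀).target ∧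
      f ((extChartAt J x₀).symm z) ∈ (extChartAt I m₀).source := by
  have h0 := extChartAt_target_mem_nhdsWithin_of_mem hy
  have h1 : ContinuousWithinAt (fun z => f ((extChartAt J x₀).symm z)) (extChartAt J x₀).target y :=
    (hf.comp_continuousOn (continuousOn_extChartAt_symm x₀)) y hy
  have h2 := h1.preimage_mem_nhdsWithin ((isOpen_extChartAt_source (I := I) m₀).mem_nhds hfy)
  have h3 : (extChartAt J x₀).target ∈ 𝓝[range J] y := h0
  filter_upwards [h3, nhdsWithin_le_of_mem h3 h2] with z hz hz'
  exact ⟨hz, hz'⟩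

theorem continuous_compContinuousLinearMap_uncurry {k : ℕ} :
    Continuous fun p : (E [⋀^Fin k]→L[ℝ] ℝ) × (E' →L[ℝ] E) =>
      p.1.compContinuousLinearMap p.2 :=
  continuous_iff_continuousAt.2 fun p =>
    (ContinuousAlternatingMap.hasStrictFDerivAt_compContinuousLinearMap p).hasFDerivAt.continuousAt

/-- A form with continuous coordinate expressions. -/
def DiffForm.IsContinuous {k : ℕ} (α : DiffForm I M k) : Prop :=
  ∀ x₀ : M, ContinuousOn (α.inChart x₀) (extChartAt I x₀).target

theorem DiffForm.IsContinuous.pullback [IsManifold I ∞ M] [IsManifold J ∞ N] {k : ℕ}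
    {α : DiffForm I M k} (hα : α.IsContinuous) {f : N → M} (hf : ContMDiff J I ∞ f) :
    (α.pullback f : DiffForm J N k).IsContinuous := by
  have : IsManifold I 1 M := .of_le (n := ∞) (by simp)
  have : IsManifold J 1 N := .of_le (n := ∞) (by simp)
  intro x₀ y hy
  let m₀ := f ((extChartAt J x₀).symm y)
  have hfy : f ((extChartAt J x₀).symm y) ∈ (extChartAt I m₀).source := mem_extChartAt_source _
  have hH := contDiffWithinAt_inCharts hf hy hfy
  have hev := eventually_mem_source_inCharts (I := I) hf.continuous hy hfy
  have hyr : y ∈ range J := extChartAt_target_subset_range x₀ hy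
  suffices h : ContinuousWithinAt (fun z => (α.inChart m₀ (inCharts I J x₀ m₀ f z)).compContinuousLinearMap
        (fderivWithin ℝ (inCharts I J x₀ m₀ f) (range J) z)) (range J) y by
    refine ContinuousWithinAt.mono (t := range J) ?_ (extChartAt_target_subset_range x₀)
    refine h.congr_of_eventuallyEq_of_mem ?_ hyr
    filter_upwards [hev] with z hz
    exact α.inChart_pullback hz.1 hz.2 (hf.mdifferentiableAt (by simp))
  have hd : ContinuousWithinAt (fderivWithin ℝ (inCharts I J x₀ m₀ f) (range J)) (range J) y :=
    (hH.fderivWithin_right (m := 0) J.uniqueDiffOn (by simp) hyr).continuousWithinAt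
  have hc : ContinuousWithinAt (fun z => α.inChart m₀ (inCharts I J x₀ m₀ f z)) (range J) y := by
    refine ContinuousWithinAt.comp_of_preimage_mem_nhdsWithin (g := α.inChart m₀)
      (f := inCharts I J x₀ m₀ f) (t := (extChartAt I m₀).target)
      (hα m₀ _ ((extChartAt I m₀).map_source hfy)) hH.continuousWithinAt ?_
    filter_upwards [hev] with z hz
    exact (extChartAt I m₀).map_source hz.2
  exact continuous_compContinuousLinearMap_uncurry.continuousAt.comp_continuousWithinAt
    (hc.prodMk hd)

end Charts

/-! ### Pullbacks of closed forms are closed at interior points. -/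

section Closed

variable {E : Type*} [NormedAddCommGroup E] [NormedSpace ℝ E]
  {H : Type*} [TopologicalSpace H] {I : ModelWithCorners ℝ E H}
  {E' : Type*} [NormedAddCommGroup E'] [NormedSpace ℝ E']
  {H' : Type*} [TopologicalSpace H'] {J : ModelWithCorners ℝ E' H'}
  {M : Type*} [TopologicalSpace M] [ChartedSpace H M]
  {N : Type*} [TopologicalSpace N] [ChartedSpace H' N]

theorem two_le_smooth : (1 + 1 : WithTop ℕ∞) ≤ ∞ := by
  rw [one_add_one_eq_two]
  exact WithTop.coe_le_coe.2 le_top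

/-- A form whose coordinate expressions are closed at the interior points. -/
def DiffForm.IsClosedInterior {k : ℕ} (α : DiffForm I M k) : Prop :=
  ∀ x₀ : M, ∀ y ∈ interior (extChartAt I x₀).target,
    DifferentiableAt ℝ (α.inChart x₀) y ∧ extDeriv (α.inChart x₀) y = 0

theorem DiffForm.IsClosed.isContinuous {k : ℕ} {α : DiffForm I M k} (hα : α.IsClosed) :
    α.IsContinuous := fun x₀ => (hα.smooth x₀).continuousOn

/-- `extDer` at `x` uses the chart at `x` only, so closedness is directly available just at the
centre of each chart. The derivative of the chart is surjective and can be stripped off. -/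
theorem DiffForm.IsClosed.extDeriv_inChart_self [I.Boundaryless] [IsManifold I 1 M] {k : ℕ}
    {α : DiffForm I M k} (hα : α.IsClosed) (x : M) :
    extDeriv (α.inChart x) (extChartAt I x x) = 0 := by
  have h : (extDerivWithin (α.inChart x) (range I) (extChartAt I x x)).compContinuousLinearMap
      (mfderivModel 𝓘(ℝ, E) I (extChartAt I x) x) = 0 := congrFun hα.extDer_eq_zero x
  rw [I.range_eq_univ, extDerivWithin_univ] at h
  have hs : Function.Surjective (mfderivModel 𝓘(ℝ, E) I (extChartAt I x) x) :=
    (isInvertible_mfderiv_extChartAt (I := I) (mem_extChartAt_source x)).surjective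
  ext v
  choose w hw using fun i => hs (v i)
  have := DFunLike.congr_fun h w
  rw [ContinuousAlternatingMap.compContinuousLinearMap_apply] at this
  rwa [show ⇑(mfderivModel 𝓘(ℝ, E) I (extChartAt I x) x) ∘ w = v from funext hw] at this

theorem DiffForm.IsClosed.isClosedInterior_pullback [I.Boundaryless] [IsManifold I ∞ M]
    [IsManifold J ∞ N] {k : ℕ} {α : DiffForm I M k} (hα : α.IsClosed) {f : N → M}
    (hf : ContMDiff J I ∞ f) : (α.pullback f : DiffForm J N k).IsClosedInterior := by
  have : IsManifold I 1 M := .of_le (n := ∞) (by simp)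
  have : IsManifold J 1 N := .of_le (n := ∞) (by simp)
  intro x₀ y hyi
  have hy := interior_subset hyi
  -- The chart of `M` is centred at the image point itself, the only point where
  -- `extDeriv_inChart_self` gives closedness in that chart.
  let m₀ := f ((extChartAt J x₀).symm y)
  have hfy : f ((extChartAt J x₀).symm y) ∈ (extChartAt I m₀).source := mem_extChartAt_source _
  have hr : ∀ z ∈ interior (extChartAt J x₀).target, range J ∈ 𝓝 z := fun z hz =>
    Filter.mem_of_superset (isOpen_interior.mem_nhds hz)
      (interior_subset.trans (extChartAt_target_subset_range x₀))
  have hH : ContDiffAt ℝ ∞ (inCharts I J x₀ m₀ f) y :=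
    (contDiffWithinAt_inCharts hf hy hfy).contDiffAt (hr y hyi)
  have hev := eventually_mem_source_inCharts (I := I) hf.continuous hy hfy
  rw [nhdsWithin_eq_nhds.2 (hr y hyi)] at hev
  have hev' : (α.pullback f : DiffForm J N k).inChart x₀ =ᶠ[𝓝 y] fun z =>
      (α.inChart m₀ (inCharts I J x₀ m₀ f z)).compContinuousLinearMap
        (fderiv ℝ (inCharts I J x₀ m₀ f) z) := by
    filter_upwards [hev, isOpen_interior.mem_nhds hyi] with z hz hz'
    rw [α.inChart_pullback hz.1 hz.2 (hf.mdifferentiableAt (by simp)),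
      fderivWithin_of_mem_nhds (hr z hz')]
  have hα' : DifferentiableAt ℝ (α.inChart m₀) (inCharts I J x₀ m₀ f y) :=
    ((hα.smooth m₀).differentiableOn (by simp)).differentiableAt
      ((isOpen_extChartAt_target m₀).mem_nhds ((extChartAt I m₀).map_source hfy))
  constructor
  · refine DifferentiableAt.congr_of_eventuallyEq ?_ hev'
    exact DifferentiableAt.continuousAlternatingMapCompContinuousLinearMap
      (hα'.comp y (hH.differentiableAt (by simp)))
      ((hH.fderiv_right (m := 1) two_le_smooth).differentiableAt (by simp))
  · rw [hev'.extDeriv_eq, extDeriv_pullback hα' hH (by simpa [one_add_one_eq_two] using two_le_smooth)]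
    have : extDeriv (α.inChart m₀) (inCharts I J x₀ m₀ f y) = 0 := hα.extDeriv_inChart_self m₀
    rw [this]
    rfl

end Closed

/-! ### Stokes' theorem on the half space. -/

section HalfSpace

variable {k : ℕ}

/-- The inclusion of the boundary hyperplane of the half space. -/
noncomputable def hyperplaneInclusion (k : ℕ) :
    EuclideanSpace ℝ (Fin k) →ₗ[ℝ] EuclideanSpace ℝ (Fin (k + 1)) where
  toFun z := WithLp.toLp 2 (Fin.cons 0 z.ofLp)
  map_add' z w := by
    ext i; refine Fin.cases ?_ (fun i => ?_) i <;> simp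
  map_smul' c z := by
    ext i; refine Fin.cases ?_ (fun i => ?_) i <;> simp

/-- The standard frame. -/
noncomputable def stdFrame (m : ℕ) (i : Fin m) : EuclideanSpace ℝ (Fin m) :=
  EuclideanSpace.single i 1

@[simp]
theorem hyperplaneInclusion_zero_apply (z : EuclideanSpace ℝ (Fin k)) :
    hyperplaneInclusion k z 0 = 0 := rfl

@[simp]
theorem hyperplaneInclusion_succ_apply (z : EuclideanSpace ℝ (Fin k)) (i : Fin k) :
    hyperplaneInclusion k z i.succ = z i := rfl

theorem extDeriv_eq_zero_of_eventually {E F : Type*} [NormedAddCommGroup E] [NormedSpace ℝ E]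
    [NormedAddCommGroup F] [NormedSpace ℝ F] {η : E → E [⋀^Fin k]→L[ℝ] F} {y : E}
    (h : ∀ᶠ z in 𝓝 y, η z = 0) : extDeriv η y = 0 := by
  have h' : η =ᶠ[𝓝 y] fun _ => 0 := h
  rw [h'.extDeriv_eq]
  ext v
  simp [extDeriv_apply]

theorem abs_apply_le_norm {m : ℕ} (y : EuclideanSpace ℝ (Fin m)) (i : Fin m) : |y i| ≤ ‖y‖ := by
  simpa using PiLp.norm_apply_le y i

/-- Divergence theorem on the box `[0, R] × [-R, R]^k`. On every face except `y 0 = 0` some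
coordinate has absolute value `R`, so `η` vanishes there. The remaining face is a lower face, which
gives the minus sign. -/
theorem integral_extDeriv_halfSpace
    {η : EuclideanSpace ℝ (Fin (k + 1)) → EuclideanSpace ℝ (Fin (k + 1)) [⋀^Fin k]→L[ℝ] ℝ}
    (hc : ContinuousOn η {y | 0 ≤ y 0}) (hd : ∀ y, 0 < y 0 → DifferentiableAt ℝ η y)
    {R : ℝ} (hR0 : 0 < R) (hR : ∀ y, 0 ≤ y 0 → R ≤ ‖y‖ → η y = 0)
    (hi : IntegrableOn (fun y => extDeriv η y (stdFrame (k + 1))) {y | 0 ≤ y 0}) :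
    ∫ y in {y | 0 ≤ y 0}, extDeriv η y (stdFrame (k + 1)) =
      -∫ z, η (hyperplaneInclusion k z) (fun a => stdFrame (k + 1) a.succ) := by
  let L := (PiLp.continuousLinearEquiv 2 ℝ (fun _ : Fin (k + 1) => ℝ)).symm
  have hL : MeasurePreserving L volume volume := PiLp.volume_preserving_toLp (Fin (k + 1))
  have hLe : MeasurableEmbedding L := L.toHomeomorph.measurableEmbedding
  have hLa : ∀ x i, L x i = x i := fun x i => rfl
  let a : Fin (k + 1) → ℝ := Fin.cons 0 fun _ => -R
  let b : Fin (k + 1) → ℝ := fun _ => R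
  have ha : ∀ i, a i ≤ 0 ∧ -R ≤ a i := Fin.cases ⟨le_rfl, by simpa [a] using hR0.le⟩
    fun i => ⟨by simpa [a] using hR0.le, by simp [a]⟩
  have hle : a ≤ b := fun i => (ha i).1.trans hR0.le
  -- The vector field dual to `η`: with the signs `(-1)^i` its divergence is `dη` on the standard
  -- frame.
  let f : Fin (k + 1) → (Fin (k + 1) → ℝ) → ℝ := fun i x =>
    (-1) ^ (i : ℕ) * η (L x) (i.removeNth (stdFrame (k + 1)))
  let f' : Fin (k + 1) → (Fin (k + 1) → ℝ) → (Fin (k + 1) → ℝ) →L[ℝ] ℝ := fun i x =>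
    ((-1 : ℝ) ^ (i : ℕ)) • (fderiv ℝ (fun y => η y (i.removeNth (stdFrame (k + 1)))) (L x)).comp
      (L : (Fin (k + 1) → ℝ) →L[ℝ] EuclideanSpace ℝ (Fin (k + 1)))
  have hsub : ∀ x ∈ Icc a b, 0 ≤ L x 0 := fun x hx => hx.1 0
  have hsum : ∀ x, 0 < x 0 → ∑ i, f' i x (Pi.single i 1) =
      extDeriv η (L x) (stdFrame (k + 1)) := by
    intro x hx
    rw [extDeriv_apply (hd (L x) hx)]
    refine Finset.sum_congr rfl fun i _ => ?_
    have e : L (Pi.single i 1) = stdFrame (k + 1) i := by ext j; simp [stdFrame, hLa, Pi.single_apply]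
    simp [f', e]
  have hae : ∀ᵐ x : Fin (k + 1) → ℝ, x 0 ≠ 0 := by
    rw [ae_iff]
    simpa [volume_pi] using Measure.pi_hyperplane (fun _ : Fin (k + 1) => (volume : Measure ℝ)) 0 0
  have hset : L ⁻¹' {y | 0 ≤ y 0} = {x | 0 ≤ x 0} := rfl
  have hms : MeasurableSet {x : Fin (k + 1) → ℝ | 0 ≤ x 0} :=
    measurableSet_le measurable_const (measurable_pi_apply 0)
  have hi' : IntegrableOn (fun x => extDeriv η (L x) (stdFrame (k + 1))) {x | 0 ≤ x 0} := by
    rw [← hset]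
    exact (hL.integrableOn_comp_preimage hLe).2 hi
  have hcongr : ∀ᵐ x : Fin (k + 1) → ℝ, x ∈ Icc a b →
      ∑ i, f' i x (Pi.single i 1) = extDeriv η (L x) (stdFrame (k + 1)) := by
    filter_upwards [hae] with x hx hx'
    exact hsum x (lt_of_le_of_ne (hsub x hx') hx.symm)
  have hfar : ∀ x : Fin (k + 1) → ℝ, 0 ≤ x 0 → ∀ i, R ≤ |x i| → η (L x) = 0 := fun x hx i hxi =>
    hR _ hx (hxi.trans (abs_apply_le_norm (L x) i))
  have hleft : ∫ y in {y | 0 ≤ y 0}, extDeriv η y (stdFrame (k + 1)) =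
      ∫ x in Icc a b, ∑ i, f' i x (Pi.single i 1) := by
    rw [← hL.setIntegral_preimage_emb hLe, hset, setIntegral_congr_ae measurableSet_Icc hcongr]
    refine setIntegral_eq_of_subset_of_ae_sdiff_eq_zero hms.nullMeasurableSet hsub ?_
    filter_upwards [hae] with x hx ⟨hx0, hxn⟩
    have hpos : 0 < x 0 := lt_of_le_of_ne hx0 hx.symm
    obtain ⟨i, hi⟩ : ∃ i, R < |x i| := by
      by_contra! hcon
      refine hxn ⟨fun i => ?_, fun i => (abs_le.1 (hcon i)).2⟩
      refine Fin.cases hx0 (fun i => ?_) i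
      simpa [a] using (abs_le.1 (hcon i.succ)).1
    rw [extDeriv_eq_zero_of_eventually]
    · rfl
    · have h1 : ∀ᶠ z in 𝓝 (L x), 0 < z 0 :=
        (by fun_prop : Continuous fun z : EuclideanSpace ℝ (Fin (k + 1)) => z 0).continuousAt.eventually
          (lt_mem_nhds hpos)
      have h2 : ∀ᶠ z in 𝓝 (L x), R < |z i| :=
        (by fun_prop : Continuous fun z : EuclideanSpace ℝ (Fin (k + 1)) => |z i|).continuousAt.eventually
          (lt_mem_nhds hi)
      filter_upwards [h1, h2] with z hz1 hz2
      exact hR z hz1.le (hz2.le.trans (abs_apply_le_norm z i))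
  rw [hleft, integral_divergence_of_hasFDerivAt_off_countable' a b hle f f' ∅ countable_empty]
  -- The second condition keeps the face inside the half space, where `η` is controlled.
  · have hface : ∀ i (c : ℝ), R ≤ |c| → 0 ≤ (if i = 0 then c else 0) →
        ∫ x in Icc (a ∘ i.succAbove) (b ∘ i.succAbove), f i (i.insertNth c x) = 0 := by
      intro i c hc hc0
      refine setIntegral_eq_zero_of_forall_eq_zero fun x hx => ?_
      have : η (L (i.insertNth c x)) = 0 := by
        refine hfar _ ?_ i (by simpa using hc)
        obtain rfl | hi0 := eq_or_ne i 0
        · simpa using hc0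
        · obtain ⟨j, hj⟩ := Fin.exists_succAbove_eq hi0.symm
          rw [← hj, Fin.insertNth_apply_succAbove]
          have := hx.1 j
          simp only [Function.comp_apply, hj] at this
          exact this
      simp [f, this]
    rw [Fin.sum_univ_succ, Finset.sum_eq_zero]
    · rw [hface 0 (b 0) (le_abs_self R) (by simpa [b] using hR0.le), add_zero, zero_sub]
      congr 1
      have hL' : MeasurePreserving (PiLp.continuousLinearEquiv 2 ℝ (fun _ : Fin k => ℝ)).symm
        volume volume := PiLp.volume_preserving_toLp (Fin k)
      rw [← hL'.integral_comp (Homeomorph.measurableEmbedding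
        (PiLp.continuousLinearEquiv 2 ℝ (fun _ : Fin k => ℝ)).symm.toHomeomorph)]
      have hg : ∀ x, f 0 ((0 : Fin (k + 1)).insertNth (a 0) x) =
          η (hyperplaneInclusion k ((PiLp.continuousLinearEquiv 2 ℝ (fun _ : Fin k => ℝ)).symm x))
            (fun a => stdFrame (k + 1) a.succ) := by
        intro x
        simp only [f, Fin.val_zero, pow_zero, one_mul, Fin.insertNth_zero]
        rfl
      simp_rw [hg]
      refine setIntegral_eq_integral_of_forall_compl_eq_zero fun x hx => ?_
      obtain ⟨i, hi⟩ : ∃ i, R < |x i| := by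
        by_contra! hcon
        exact hx ⟨fun i => by simpa [a] using (abs_le.1 (hcon i)).1, fun i => (abs_le.1 (hcon i)).2⟩
      rw [hR _ (by simp)]
      · rfl
      · exact hi.le.trans (abs_apply_le_norm
          (hyperplaneInclusion k ((PiLp.continuousLinearEquiv 2 ℝ (fun _ : Fin k => ℝ)).symm x)) i.succ)
    · intro i _
      rw [hface i.succ (b i.succ) (le_abs_self R) (by simp [Fin.succ_ne_zero]),
        hface i.succ (a i.succ) (by simp [a, le_abs_self]) (by simp [Fin.succ_ne_zero]), sub_zero]
  · intro i
    have h1 : ContinuousOn (fun x => η (L x)) (Icc a b) := hc.comp L.continuous.continuousOn hsub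
    exact continuousOn_const.mul ((continuous_eval_const (F := EuclideanSpace ℝ (Fin (k + 1))
      [⋀^Fin k]→L[ℝ] ℝ) (i.removeNth (stdFrame (k + 1)))).comp_continuousOn h1)
  · intro x hx i
    have hx0 : 0 < L x 0 := (hx.1 0 (mem_univ _)).1
    have h1 := ((hd _ hx0).continuousAlternatingMap_apply_const
      (i.removeNth (stdFrame (k + 1)))).hasFDerivAt
    exact (h1.comp x L.hasFDerivAt).const_mul _
  · refine (hi'.mono_set hsub).congr_fun_ae ?_
    rw [Filter.EventuallyEq, ae_restrict_iff' measurableSet_Icc]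
    filter_upwards [hcongr] with x hx hx' using (hx hx').symm

end HalfSpace

/-! ### Densities in charts and independence of the chart. -/

section Density

variable {m : ℕ} {H : Type*} [TopologicalSpace H]
  {I : ModelWithCorners ℝ (EuclideanSpace ℝ (Fin m)) H}
  {N : Type*} [TopologicalSpace N] [ChartedSpace H N]

theorem det_stdBasis_comp (A : EuclideanSpace ℝ (Fin m) →L[ℝ] EuclideanSpace ℝ (Fin m)) :
    (EuclideanSpace.basisFun (Fin m) ℝ).toBasis.det (fun i => A (stdFrame m i)) = A.det := by
  have h := (EuclideanSpace.basisFun (Fin m) ℝ).toBasis.det_comp A.toLinearMap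
    (EuclideanSpace.basisFun (Fin m) ℝ).toBasis
  rw [Basis.det_self, mul_one] at h
  rw [ContinuousLinearMap.det, ← h]
  congr 1
  funext i
  simp [stdFrame]

theorem orientedValue_comp (o : Orientation ℝ (EuclideanSpace ℝ (Fin m)) (Fin m))
    (α : EuclideanSpace ℝ (Fin m) [⋀^Fin m]→L[ℝ] ℝ)
    {D : EuclideanSpace ℝ (Fin m) →L[ℝ] EuclideanSpace ℝ (Fin m)} (hD : D.IsInvertible)
    (A : EuclideanSpace ℝ (Fin m) →L[ℝ] EuclideanSpace ℝ (Fin m)) :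
    orientedValue o α (fun i => D (A (stdFrame m i))) =
      |A.det| * orientedValue o α (fun i => D (stdFrame m i)) := by
  obtain ⟨e, rfl⟩ := hD
  let b := (EuclideanSpace.basisFun (Fin m) ℝ).toBasis.map e.toLinearEquiv
  have hb : ⇑b = fun i => e (stdFrame m i) := by funext i; simp [b, stdFrame]
  have hdet : b.det (fun i => e (A (stdFrame m i))) = A.det := by
    rw [Basis.det_map, ← det_stdBasis_comp]
    congr 1
    funext i
    simp
  have h := orientedValue_eq_abs_det_mul o α b (fun i => e (A (stdFrame m i)))
  rwa [hdet, hb] at h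

/-- The density of an `m`-form over an oriented `m`-manifold, in the preferred chart at `x₀`. -/
noncomputable def chartDensity (o : ManifoldOrientation I N) (α : DiffForm I N m) (x₀ : N)
    (y : EuclideanSpace ℝ (Fin m)) : ℝ :=
  orientedValue (o.toFun ((extChartAt I x₀).symm y)) (α ((extChartAt I x₀).symm y))
    (chartFrame I x₀ y)

/-- The sign of the coordinate frame. -/
noncomputable def chartSign (o : ManifoldOrientation I N) (x₀ : N)
    (y : EuclideanSpace ℝ (Fin m)) : ℝ :=
  frameSign (o.toFun ((extChartAt I x₀).symm y)) (chartFrame I x₀ y)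

/-- The integral of the density of a form over the target of the preferred chart at `x₀`. -/
noncomputable def chartIntegral (o : ManifoldOrientation I N) (α : DiffForm I N m) (x₀ : N) : ℝ :=
  ∫ y in (extChartAt I x₀).target, chartDensity o α x₀ y

theorem chartDensity_eq (o : ManifoldOrientation I N) (α : DiffForm I N m) (x₀ : N)
    (y : EuclideanSpace ℝ (Fin m)) :
    chartDensity o α x₀ y = chartSign o x₀ y * α.inChart x₀ y (stdFrame m) := by
  rw [chartDensity, orientedValue_eq_frameSign_mul]
  rfl

theorem chartSign_eventually_eq (o : ManifoldOrientation I N) {x₀ : N}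
    {y₀ : EuclideanSpace ℝ (Fin m)} (hy₀ : y₀ ∈ (extChartAt I x₀).target) :
    ∀ᶠ y in 𝓝[(extChartAt I x₀).target] y₀, chartSign o x₀ y = chartSign o x₀ y₀ := by
  filter_upwards [o.locallyConstant x₀ y₀ hy₀] with y hy using frameSign_congr hy

theorem continuousOn_chartSign (o : ManifoldOrientation I N) (x₀ : N) :
    ContinuousOn (chartSign o x₀) (extChartAt I x₀).target := fun _ hy =>
  continuousWithinAt_const.congr_of_eventuallyEq (chartSign_eventually_eq o hy) rfl

theorem chartDensity_eq_zero (o : ManifoldOrientation I N) {α : DiffForm I N m} {x₀ : N}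
    {y : EuclideanSpace ℝ (Fin m)} (h : α ((extChartAt I x₀).symm y) = 0) :
    chartDensity o α x₀ y = 0 := by
  rw [chartDensity, h, orientedValue_eq_frameSign_mul]
  exact mul_zero _

theorem continuousOn_chartDensity (o : ManifoldOrientation I N) {α : DiffForm I N m}
    (hα : α.IsContinuous) (x₀ : N) :
    ContinuousOn (chartDensity o α x₀) (extChartAt I x₀).target := by
  refine ((continuousOn_chartSign o x₀).mul ((continuous_eval_const
    (F := EuclideanSpace ℝ (Fin m) [⋀^Fin m]→L[ℝ] ℝ) (stdFrame m)).comp_continuousOn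
    (hα x₀))).congr fun y _ => chartDensity_eq o α x₀ y

theorem measurableSet_extChartAt_target (x₀ : N) : MeasurableSet (extChartAt I x₀).target := by
  rw [extChartAt_target]
  exact ((chartAt H x₀).open_target.preimage I.continuous_symm).measurableSet.inter
    I.isClosed_range.measurableSet

theorem measurableSet_target_inter_preimage {X : Type*} [TopologicalSpace X] {f : N → X}
    (hf : Continuous f) {U : Set X} (hU : IsOpen U) (x₀ : N) :
    MeasurableSet {y | y ∈ (extChartAt I x₀).target ∧ f ((extChartAt I x₀).symm y) ∈ U} := by
  obtain ⟨u, hu, h⟩ := continuousOn_iff'.1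
    (hf.comp_continuousOn (continuousOn_extChartAt_symm (I := I) x₀)) U hU
  have e : {y | y ∈ (extChartAt I x₀).target ∧ f ((extChartAt I x₀).symm y) ∈ U} =
      u ∩ (extChartAt I x₀).target := by
    rw [← h]; ext y; exact and_comm
  rw [e]
  exact hu.measurableSet.inter (measurableSet_extChartAt_target x₀)

theorem isCompact_image_extChartAt {x₀ : N} {K : Set N} (hK : IsCompact K)
    (hs : K ⊆ (extChartAt I x₀).source) : IsCompact (extChartAt I x₀ '' K) :=
  hK.image_of_continuousOn ((continuousOn_extChartAt x₀).mono hs)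

theorem symm_notMem_of_notMem_image {x₀ : N} {K : Set N}
    {y : EuclideanSpace ℝ (Fin m)} (hy : y ∈ (extChartAt I x₀).target)
    (hyK : y ∉ extChartAt I x₀ '' K) : (extChartAt I x₀).symm y ∉ K := fun h =>
  hyK ⟨_, h, (extChartAt I x₀).right_inv hy⟩

theorem integrableOn_of_continuousOn {E : Type*} [TopologicalSpace E] [T2Space E]
    [MeasurableSpace E] [BorelSpace E]
    {μ : Measure E} [IsFiniteMeasureOnCompacts μ] {f : E → ℝ} {T K : Set E}
    (hT : MeasurableSet T) (hK : IsCompact K) (hKT : K ⊆ T)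
    (hf : ContinuousOn f T) (h0 : ∀ y ∈ T, y ∉ K → f y = 0) : IntegrableOn f T μ :=
  ((hf.mono hKT).integrableOn_compact hK).of_forall_sdiff_eq_zero hT fun y hy => h0 y hy.1 hy.2

theorem integrableOn_chartDensity (o : ManifoldOrientation I N) {α : DiffForm I N m}
    (hα : α.IsContinuous) {x₀ : N} {K : Set N} (hK : IsCompact K)
    (hs : K ⊆ (extChartAt I x₀).source) (h0 : ∀ x, x ∉ K → α x = 0) :
    IntegrableOn (chartDensity o α x₀) (extChartAt I x₀).target :=
  integrableOn_of_continuousOn (measurableSet_extChartAt_target x₀) (isCompact_image_extChartAt hK hs)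
    (image_subset_iff.2 fun _ hx => (extChartAt I x₀).map_source (hs hx))
    (continuousOn_chartDensity o hα x₀) fun _ hy hyK =>
      chartDensity_eq_zero o (h0 _ (symm_notMem_of_notMem_image hy hyK))

/-- Both integrals reduce to the overlap of the two charts, where the transition map `τ` is
injective and the densities differ by `|det τ'|`. -/
theorem chartIntegral_eq_of_support [IsManifold I ∞ N] (o : ManifoldOrientation I N)
    {α : DiffForm I N m} {x₀ x₁ : N}
    (h : ∀ x, ¬ (x ∈ (extChartAt I x₀).source ∧ x ∈ (extChartAt I x₁).source) → α x = 0) :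
    chartIntegral o α x₀ = chartIntegral o α x₁ := by
  have : IsManifold I 1 N := .of_le (n := ∞) (by simp)
  let S : Set (EuclideanSpace ℝ (Fin m)) :=
    {y | y ∈ (extChartAt I x₀).target ∧ (extChartAt I x₀).symm y ∈ (extChartAt I x₁).source}
  let τ := inCharts I I x₀ x₁ (id : N → N)
  let τ' := fderivWithin ℝ τ (range I)
  have hSm : MeasurableSet S :=
    measurableSet_target_inter_preimage continuous_id (isOpen_extChartAt_source x₁) x₀
  have himg : τ '' S = {y | y ∈ (extChartAt I x₁).target ∧
      (extChartAt I x₁).symm y ∈ (extChartAt I x₀).source} := by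
    ext z
    constructor
    · rintro ⟨y, ⟨hy, hy'⟩, rfl⟩
      refine ⟨(extChartAt I x₁).map_source hy', ?_⟩
      simp only [τ, inCharts, id]
      rw [(extChartAt I x₁).left_inv hy']
      exact (extChartAt I x₀).map_target hy
    · rintro ⟨hz, hz'⟩
      have e : (extChartAt I x₀).symm (extChartAt I x₀ ((extChartAt I x₁).symm z)) =
        (extChartAt I x₁).symm z := (extChartAt I x₀).left_inv hz'
      refine ⟨extChartAt I x₀ ((extChartAt I x₁).symm z),
        ⟨(extChartAt I x₀).map_source hz', ?_⟩, ?_⟩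
      · rw [e]; exact (extChartAt I x₁).map_target hz
      · simp only [τ, inCharts, id]
        rw [e, (extChartAt I x₁).right_inv hz]
  have hinj : InjOn τ S := by
    intro y hy z hz hyz
    have := (extChartAt I x₁).injOn hy.2 hz.2 hyz
    exact (extChartAt I x₀).symm.injOn hy.1 hz.1 this
  have hder : ∀ y ∈ S, HasFDerivWithinAt τ (τ' y) S y := fun y hy =>
    ((contDiffWithinAt_inCharts contMDiff_id hy.1 hy.2).differentiableWithinAt
      (by simp)).hasFDerivWithinAt.mono fun z hz => extChartAt_target_subset_range x₀ hz.1
  have hdens : ∀ y ∈ S, chartDensity o α x₀ y = |(τ' y).det| • chartDensity o α x₁ (τ y) := by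
    intro y hy
    have hk := chartSymmDeriv_comp_fderivWithin (I := I) (J := I) (f := (id : N → N)) hy.1 hy.2
      mdifferentiableAt_id
    have hid : mfderivModel I I (id : N → N) ((extChartAt I x₀).symm y) =
      ContinuousLinearMap.id ℝ _ := mfderiv_id
    rw [hid, ContinuousLinearMap.id_comp] at hk
    have hinv : (chartSymmDeriv I x₁ (τ y)).IsInvertible :=
      isInvertible_mfderivWithin_extChartAt_symm (I := I) ((extChartAt I x₁).map_source hy.2)
    have he : (extChartAt I x₁).symm (τ y) = (extChartAt I x₀).symm y :=
      (extChartAt I x₁).left_inv hy.2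
    let o' : N → Orientation ℝ (EuclideanSpace ℝ (Fin m)) (Fin m) := o.toFun
    let α' : N → EuclideanSpace ℝ (Fin m) [⋀^Fin m]→L[ℝ] ℝ := α
    have h1 := orientedValue_comp (o' ((extChartAt I x₁).symm (τ y)))
      (α' ((extChartAt I x₁).symm (τ y))) hinv (τ' y)
    have h2 : (fun i => chartSymmDeriv I x₁ (τ y) (τ' y (stdFrame m i))) =
        fun i => chartSymmDeriv I x₀ y (stdFrame m i) := by
      funext i
      rw [← hk]
      rfl
    rw [h2] at h1
    have h3 : orientedValue (o' ((extChartAt I x₀).symm y)) (α' ((extChartAt I x₀).symm y))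
      (fun i => chartSymmDeriv I x₀ y (stdFrame m i)) = chartDensity o α x₀ y := rfl
    rw [← h3, ← he, h1]
    rfl
  have hL : chartIntegral o α x₀ = ∫ y in S, chartDensity o α x₀ y := by
    refine setIntegral_eq_of_subset_of_forall_sdiff_eq_zero (measurableSet_extChartAt_target x₀)
      (fun y hy => hy.1) fun y hy => chartDensity_eq_zero o (h _ fun hh => hy.2 ⟨hy.1, hh.2⟩)
  have hR : chartIntegral o α x₁ = ∫ y in τ '' S, chartDensity o α x₁ y := by
    rw [himg]
    refine setIntegral_eq_of_subset_of_forall_sdiff_eq_zero (measurableSet_extChartAt_target x₁)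
      (fun y hy => hy.1) fun y hy => chartDensity_eq_zero o (h _ fun hh => hy.2 ⟨hy.1, hh.1⟩)
  rw [hL, hR, integral_image_eq_integral_abs_det_fderiv_smul _ hSm hder hinj]
  exact setIntegral_congr_fun hSm hdens

end Density

/-! ### The form `dχ ∧ η`. -/

section Wedge

variable {E : Type*} [NormedAddCommGroup E] [NormedSpace ℝ E]
  {H : Type*} [TopologicalSpace H] {I : ModelWithCorners ℝ E H}
  {N : Type*} [TopologicalSpace N] [ChartedSpace H N] {k : ℕ}

namespace DiffForm

/-- The product of a function and a form. -/
noncomputable def smulFun (q : N → ℝ) (α : DiffForm I N k) : DiffForm I N k := fun x => q x • α x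

theorem inChart_smulFun (q : N → ℝ) (α : DiffForm I N k) (x₀ : N) (y : E) :
    (smulFun q α).inChart x₀ y = q ((extChartAt I x₀).symm y) • α.inChart x₀ y := rfl

theorem IsContinuous.smulFun {q : N → ℝ} (hq : Continuous q) {α : DiffForm I N k}
    (hα : α.IsContinuous) : (smulFun q α).IsContinuous := fun x₀ => by
  have h : ContinuousOn (fun y => q ((extChartAt I x₀).symm y) • α.inChart x₀ y)
      (extChartAt I x₀).target :=
    (hq.comp_continuousOn (continuousOn_extChartAt_symm x₀)).smul (hα x₀)
  exact h

/-- The wedge product of a linear form and an alternating form. -/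
noncomputable def wedgeLeft (c : E →L[ℝ] ℝ) (a : E [⋀^Fin k]→L[ℝ] ℝ) : E [⋀^Fin (k + 1)]→L[ℝ] ℝ :=
  ContinuousAlternatingMap.alternatizeUncurryFinCLM ℝ E ℝ (ContinuousLinearMap.smulRightL ℝ E _ c a)

theorem wedgeLeft_apply (c : E →L[ℝ] ℝ) (a : E [⋀^Fin k]→L[ℝ] ℝ) (v : Fin (k + 1) → E) :
    wedgeLeft c a v = ∑ i, (-1) ^ i.val • (c (v i) • a (i.removeNth v)) :=
  ContinuousAlternatingMap.alternatizeUncurryFin_apply (c.smulRight a) v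

@[simp]
theorem wedgeLeft_zero (a : E [⋀^Fin k]→L[ℝ] ℝ) : wedgeLeft 0 a = 0 := by
  rw [wedgeLeft, map_zero, _root_.zero_apply, map_zero]

theorem wedgeLeft_sum {ι : Type*} (s : Finset ι) (c : ι → E →L[ℝ] ℝ) (a : E [⋀^Fin k]→L[ℝ] ℝ) :
    wedgeLeft (∑ i ∈ s, c i) a = ∑ i ∈ s, wedgeLeft (c i) a := by
  simp only [wedgeLeft, map_sum, _root_.sum_apply]

/-- The wedge product `dχ ∧ η` of the differential of a function and a form. -/
noncomputable def dWedge (χ : N → ℝ) (η : DiffForm I N k) : DiffForm I N (k + 1) := fun x =>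
  wedgeLeft (E := E) (mfderivModel 𝓘(ℝ, ℝ) I χ x) (η x)

theorem fderivWithin_comp_extChartAt_symm [IsManifold I 1 N] {χ : N → ℝ} {x₀ : N} {y : E}
    (hy : y ∈ (extChartAt I x₀).target)
    (hχ : MDifferentiableAt I 𝓘(ℝ, ℝ) χ ((extChartAt I x₀).symm y)) :
    fderivWithin ℝ (χ ∘ (extChartAt I x₀).symm) (range I) y =
      (mfderivModel 𝓘(ℝ, ℝ) I χ ((extChartAt I x₀).symm y)).comp (chartSymmDeriv I x₀ y) := by
  have U : UniqueMDiffWithinAt 𝓘(ℝ, E) (range I) y :=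
    I.uniqueMDiffOn _ (extChartAt_target_subset_range x₀ hy)
  rw [← mfderivWithin_eq_fderivWithin]
  exact mfderiv_comp_mfderivWithin y hχ (mdifferentiableWithinAt_extChartAt_symm hy) U

theorem inChart_dWedge [IsManifold I 1 N] {χ : N → ℝ} (η : DiffForm I N k) {x₀ : N} {y : E}
    (hy : y ∈ (extChartAt I x₀).target)
    (hχ : MDifferentiableAt I 𝓘(ℝ, ℝ) χ ((extChartAt I x₀).symm y)) :
    (dWedge χ η).inChart x₀ y =
      wedgeLeft (fderivWithin ℝ (χ ∘ (extChartAt I x₀).symm) (range I) y) (η.inChart x₀ y) := by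
  rw [fderivWithin_comp_extChartAt_symm hy hχ]
  ext v
  rw [inChart_apply, wedgeLeft_apply]
  exact wedgeLeft_apply _ _ _

theorem IsContinuous.dWedge [IsManifold I ∞ N] {χ : N → ℝ} (hχ : ContMDiff I 𝓘(ℝ, ℝ) ∞ χ)
    {η : DiffForm I N k} (hη : η.IsContinuous) : (dWedge χ η).IsContinuous := by
  have : IsManifold I 1 N := .of_le (n := ∞) (by simp)
  intro x₀
  have h1 : ContinuousOn (fderivWithin ℝ (χ ∘ (extChartAt I x₀).symm) (range I))
      (extChartAt I x₀).target := by
    intro y hy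
    have hs : ContDiffWithinAt ℝ ∞ (χ ∘ (extChartAt I x₀).symm) (range I) y := by
      rw [← contMDiffWithinAt_iff_contDiffWithinAt]
      exact (hχ _).comp_contMDiffWithinAt y (contMDiffWithinAt_extChartAt_symm_range x₀ hy)
    have hr := extChartAt_target_subset_range (I := I) x₀
    exact ((hs.fderivWithin_right (m := 0) I.uniqueDiffOn (by simp)
      (hr hy)).continuousWithinAt).mono hr
  have h2 : ContinuousOn (fun y => ContinuousAlternatingMap.alternatizeUncurryFinCLM ℝ E ℝ
      (ContinuousLinearMap.smulRightL ℝ E _ (fderivWithin ℝ (χ ∘ (extChartAt I x₀).symm) (range I) y)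
        (η.inChart x₀ y))) (extChartAt I x₀).target :=
    (ContinuousLinearMap.continuous _).comp_continuousOn
      (((ContinuousLinearMap.continuous _).comp_continuousOn h1).clm_apply (hη x₀))
  exact h2.congr fun y hy => inChart_dWedge η hy (hχ.mdifferentiableAt (by simp))

theorem dWedge_eq_zero {χ : N → ℝ} (η : DiffForm I N k) {x : N} (hx : x ∉ tsupport χ) :
    dWedge χ η x = 0 := by
  have h1 : χ =ᶠ[𝓝 x] fun _ => 0 := notMem_tsupport_iff_eventuallyEq.1 hx
  have h2 : mfderivModel 𝓘(ℝ, ℝ) I χ x = 0 := h1.mfderiv_eq.trans mfderiv_const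
  rw [dWedge, h2]
  exact wedgeLeft_zero _

theorem hasMFDerivAt_finset_sum {ι : Type*} (s : Finset ι) {χ : ι → N → ℝ} {x : N}
    {χ' : ι → E →L[ℝ] ℝ} (h : ∀ i ∈ s, HasMFDerivAt I 𝓘(ℝ, ℝ) (χ i) x (χ' i)) :
    HasMFDerivAt I 𝓘(ℝ, ℝ) (fun x => ∑ i ∈ s, χ i x) x (∑ i ∈ s, χ' i) := by
  classical
  induction s using Finset.induction_on with
  | empty => exact hasMFDerivAt_const _ _
  | insert i s hi ih =>
    have e : (fun x => ∑ j ∈ insert i s, χ j x) = χ i + fun x => ∑ j ∈ s, χ j x :=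
      funext fun x => Finset.sum_insert hi
    rw [e]
    exact ((h i (Finset.mem_insert_self i s)).add
      (ih fun j hj => h j (Finset.mem_insert_of_mem hj))).congr_mfderiv (Finset.sum_insert hi).symm

/-- The differentials of the `χ i` add up to the differential of the constant 1. -/
theorem sum_dWedge_eq_zero {ι : Type*} (s : Finset ι) {χ : ι → N → ℝ}
    (hχ : ∀ i ∈ s, MDifferentiable I 𝓘(ℝ, ℝ) (χ i)) (hs : ∀ x, ∑ i ∈ s, χ i x = 1)
    (η : DiffForm I N k) : ∑ i ∈ s, dWedge (χ i) η = 0 := by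
  funext x
  have h1 : ∑ i ∈ s, mfderivModel 𝓘(ℝ, ℝ) I (χ i) x = 0 := by
    have h2 := hasMFDerivAt_finset_sum s fun i hi => (hχ i hi x).hasMFDerivAt
    rw [show (fun x => ∑ i ∈ s, χ i x) = fun _ => 1 from funext hs] at h2
    exact hasMFDerivAt_unique h2 (hasMFDerivAt_const _ _)
  rw [Finset.sum_apply]
  have h4 := wedgeLeft_sum s (fun i => mfderivModel 𝓘(ℝ, ℝ) I (χ i) x)
    (show E [⋀^Fin k]→L[ℝ] ℝ from η x)
  rw [h1, wedgeLeft_zero] at h4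
  exact h4.symm

end DiffForm

end Wedge

/-! ### Sums over a partition of unity. -/

section PartitionSums

variable {m : ℕ} {H : Type*} [TopologicalSpace H]
  {I : ModelWithCorners ℝ (EuclideanSpace ℝ (Fin m)) H}
  {N : Type*} [TopologicalSpace N] [ChartedSpace H N]

theorem chartDensity_smulFun (o : ManifoldOrientation I N) (q : N → ℝ) (α : DiffForm I N m) (x₀ : N)
    (y : EuclideanSpace ℝ (Fin m)) : chartDensity o (α.smulFun q) x₀ y =
      q ((extChartAt I x₀).symm y) * chartDensity o α x₀ y := by
  rw [chartDensity_eq, chartDensity_eq, DiffForm.inChart_smulFun, ContinuousAlternatingMap.smul_apply,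
    smul_eq_mul]
  ring

theorem chartDensity_sum {ι : Type*} (o : ManifoldOrientation I N) (s : Finset ι)
    (α : ι → DiffForm I N m) (x₀ : N) (y : EuclideanSpace ℝ (Fin m)) :
    chartDensity o (∑ i ∈ s, α i) x₀ y = ∑ i ∈ s, chartDensity o (α i) x₀ y := by
  simp only [chartDensity, orientedValue_eq_frameSign_mul, ← Finset.mul_sum, Finset.sum_apply]
  congr 1
  exact ContinuousAlternatingMap.sum_apply _ _

theorem chartIntegral_sum {ι : Type*} (o : ManifoldOrientation I N) (s : Finset ι)
    (α : ι → DiffForm I N m) (x₀ : N)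
    (h : ∀ i ∈ s, IntegrableOn (chartDensity o (α i) x₀) (extChartAt I x₀).target) :
    chartIntegral o (∑ i ∈ s, α i) x₀ = ∑ i ∈ s, chartIntegral o (α i) x₀ := by
  simp only [chartIntegral, chartDensity_sum]
  exact integral_finsetSum s h

theorem SmoothPartitionOfUnity.exists_finset [CompactSpace N]
    {ι : Type*} (ρ : SmoothPartitionOfUnity ι I N univ) :
    ∃ s : Finset ι, (∀ i ∉ s, ⇑(ρ i) = 0) ∧ ∀ x, ∑ i ∈ s, ρ i x = 1 := by
  have hf := ρ.locallyFinite.finite_nonempty_of_compact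
  have h0 : ∀ i ∉ hf.toFinset, ⇑(ρ i) = 0 := by
    intro i hi
    simpa [not_nonempty_iff_eq_empty] using hi
  refine ⟨hf.toFinset, h0, fun x => ?_⟩
  rw [← ρ.sum_eq_one (mem_univ x)]
  refine (finsum_eq_sum_of_support_subset _ fun i hi => ?_).symm
  by_contra hi'
  exact hi (congrFun (h0 i hi') x)

variable [IsManifold I ∞ N] [T2Space N] [CompactSpace N]

theorem tsupport_chartPartition_subset (x₀ : N) :
    tsupport (chartPartition I N x₀) ⊆ (extChartAt I x₀).source := by
  rw [extChartAt_source]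
  exact (SmoothPartitionOfUnity.exists_isSubordinate_chartAt_source I N).choose_spec x₀

theorem isCompact_tsupport_chartPartition (x₀ : N) :
    IsCompact (tsupport (chartPartition I N x₀)) := (isClosed_tsupport _).isCompact

theorem smulFun_chartPartition_eq_zero {k : ℕ} (α : DiffForm I N k) {x₀ x : N}
    (hx : x ∉ tsupport (chartPartition I N x₀)) :
    α.smulFun (chartPartition I N x₀) x = 0 := by
  rw [DiffForm.smulFun, image_eq_zero_of_notMem_tsupport hx, zero_smul]

theorem integrableOn_chartDensity_chartPartition_smul (o : ManifoldOrientation I N)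
    {α : DiffForm I N m} (hα : α.IsContinuous) (x₀ : N) :
    IntegrableOn (chartDensity o (α.smulFun (chartPartition I N x₀)) x₀) (extChartAt I x₀).target :=
  integrableOn_chartDensity o (hα.smulFun (chartPartition I N x₀).2.continuous)
    (isCompact_tsupport_chartPartition x₀) (tsupport_chartPartition_subset x₀)
    fun _ => smulFun_chartPartition_eq_zero α

theorem integralForm_eq_sum (o : ManifoldOrientation I N) (α : DiffForm I N m) {s : Finset N}
    (hs : ∀ i ∉ s, ⇑(chartPartition I N i) = 0) :
    integralForm o α = ∑ x₀ ∈ s, chartIntegral o (α.smulFun (chartPartition I N x₀)) x₀ := by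
  have h : integralForm o α =
      ∑ᶠ x₀, chartIntegral o (α.smulFun (chartPartition I N x₀)) x₀ := by
    simp only [chartIntegral, chartDensity_smulFun]
    rfl
  rw [h]
  refine finsum_eq_sum_of_support_subset _ fun i hi => ?_
  by_contra hi'
  refine hi ?_
  simp only [chartIntegral, chartDensity_smulFun, hs i hi']
  simp

/-- The terms live in different charts and cannot be added directly. Each `β a` is split as `∑ b, χ
b • β a`, and each piece is moved from the chart at `a` to the chart at `b`. After exchanging the
sums, the integrands in the chart at `b` add up to zero. -/
theorem sum_chartIntegral_eq_zero (o : ManifoldOrientation I N) {s : Finset N}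
    (hs : ∀ x, ∑ i ∈ s, chartPartition I N i x = 1) {β : N → DiffForm I N m}
    (hβ : ∀ a ∈ s, (β a).IsContinuous)
    (hβ0 : ∀ a x, x ∉ tsupport (chartPartition I N a) → β a x = 0) (hsum : ∑ a ∈ s, β a = 0) :
    ∑ a ∈ s, chartIntegral o (β a) a = 0 := by
  let χ := chartPartition I N
  have hsm : ∀ a b x, x ∉ tsupport (χ a) → (β a).smulFun (χ b) x = 0 := fun a b x hx => by
    rw [DiffForm.smulFun, hβ0 a x hx, smul_zero]
  have h1 : ∀ a ∈ s, chartIntegral o (β a) a = ∑ b ∈ s, chartIntegral o ((β a).smulFun (χ b)) b := by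
    intro a ha
    have e : β a = ∑ b ∈ s, (β a).smulFun (χ b) := by
      funext x
      rw [Finset.sum_apply]
      simp only [DiffForm.smulFun]
      rw [← Finset.sum_smul, hs x, one_smul]
    conv_lhs => rw [e]
    rw [chartIntegral_sum]
    · refine Finset.sum_congr rfl fun b _ => chartIntegral_eq_of_support o fun x hx => ?_
      by_cases hxa : x ∈ tsupport (χ a)
      · refine smulFun_chartPartition_eq_zero _ fun hxb => hx
          ⟨tsupport_chartPartition_subset a hxa, tsupport_chartPartition_subset b hxb⟩
      · exact hsm a b x hxa
    · exact fun b _ => integrableOn_chartDensity o ((hβ a ha).smulFun (χ b).2.continuous)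
        (isCompact_tsupport_chartPartition a) (tsupport_chartPartition_subset a) (hsm a b)
  rw [Finset.sum_congr rfl h1, Finset.sum_comm]
  refine Finset.sum_eq_zero fun b _ => ?_
  rw [← chartIntegral_sum]
  · have e : ∑ a ∈ s, (β a).smulFun (χ b) = 0 := by
      funext x
      rw [Finset.sum_apply]
      simp only [DiffForm.smulFun]
      rw [← Finset.smul_sum, ← Finset.sum_apply, hsum]
      exact smul_zero _
    rw [e, chartIntegral]
    refine setIntegral_eq_zero_of_forall_eq_zero fun y _ => chartDensity_eq_zero o rfl
  · exact fun a ha => integrableOn_chartDensity_chartPartition_smul o (hβ a ha) b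

end PartitionSums

/-! ### Stokes' theorem in one chart of a manifold with boundary. -/

section LocalStokes

/-- Leibniz rule without the term `f dη`. The constant `c` will be the local value of the chart
sign. -/
theorem extDeriv_smul_of_closed {E : Type*} [NormedAddCommGroup E] [NormedSpace ℝ E] {k : ℕ}
    {f : E → ℝ} {η : E → E [⋀^Fin k]→L[ℝ] ℝ} {y : E} (hf : DifferentiableAt ℝ f y)
    (hη : DifferentiableAt ℝ η y) (h0 : extDeriv η y = 0) (c : ℝ) :
    extDeriv (fun z => (c * f z) • η z) y = c • DiffForm.wedgeLeft (fderiv ℝ f y) (η y) := by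
  have h1 : fderiv ℝ (fun z => (c * f z) • η z) y =
      (c * f y) • fderiv ℝ η y + c • (fderiv ℝ f y).smulRight (η y) := by
    rw [fderiv_fun_smul (hf.const_mul c) hη, fderiv_const_mul hf]
    ext v w
    simp [mul_assoc]
  rw [extDeriv] at h0 ⊢
  rw [h1, ContinuousAlternatingMap.alternatizeUncurryFin_add,
    ContinuousAlternatingMap.alternatizeUncurryFin_smul, h0, smul_zero, zero_add,
    ContinuousAlternatingMap.alternatizeUncurryFin_smul]
  rfl

variable {k : ℕ} {W : Type*} [TopologicalSpace W] [ChartedSpace (EuclideanHalfSpace (k + 1)) W]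

/-- The density of a `k`-form over the boundary of an oriented `(k + 1)`-manifold, in the preferred
chart at `a`, up to the sign of the boundary orientation. -/
noncomputable def boundaryDensity (o : ManifoldOrientation (𝓡∂ (k + 1)) W)
    (η : DiffForm (𝓡∂ (k + 1)) W k) (a : W) (z : EuclideanSpace ℝ (Fin k)) : ℝ :=
  chartSign o a (hyperplaneInclusion k z) *
    η.inChart a (hyperplaneInclusion k z) (fun i => stdFrame (k + 1) i.succ)

variable (k) in
theorem ae_apply_zero_ne_zero : ∀ᵐ y : EuclideanSpace ℝ (Fin (k + 1)), y 0 ≠ 0 := by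
  have h := Measure.addHaar_submodule (volume : Measure (EuclideanSpace ℝ (Fin (k + 1))))
    (LinearMap.ker (EuclideanSpace.proj (𝕜 := ℝ) (0 : Fin (k + 1))).toLinearMap) (fun h => by
      have h1 : stdFrame (k + 1) 0 ∈ (⊤ : Submodule ℝ (EuclideanSpace ℝ (Fin (k + 1)))) := trivial
      rw [← h] at h1
      simp [stdFrame] at h1)
  rw [ae_iff]
  convert h using 2
  ext y
  simp

theorem range_modelWithCorners_halfSpace :
    range (𝓡∂ (k + 1)) = {y : EuclideanSpace ℝ (Fin (k + 1)) | 0 ≤ y 0} :=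
  range_modelWithCornersEuclideanHalfSpace (k + 1)

theorem extChartAt_target_subset_halfSpace (a : W) :
    (extChartAt (𝓡∂ (k + 1)) a).target ⊆ {y | 0 ≤ y 0} := by
  rw [← range_modelWithCorners_halfSpace]
  exact extChartAt_target_subset_range a

theorem extChartAt_target_mem_nhds_of_pos {a : W} {y : EuclideanSpace ℝ (Fin (k + 1))}
    (hy : y ∈ (extChartAt (𝓡∂ (k + 1)) a).target) (hy0 : 0 < y 0) :
    (extChartAt (𝓡∂ (k + 1)) a).target ∈ 𝓝 y := by
  have h := extChartAt_target_mem_nhdsWithin_of_mem hy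
  rwa [range_modelWithCorners_halfSpace, nhdsWithin_eq_nhds.2] at h
  have h1 : ∀ᶠ z in 𝓝 y, 0 < z 0 :=
    (by fun_prop : Continuous fun z : EuclideanSpace ℝ (Fin (k + 1)) => z 0).continuousAt.eventually
      (lt_mem_nhds hy0)
  filter_upwards [h1] with z hz using hz.le

variable [IsManifold (𝓡∂ (k + 1)) ∞ W]

theorem chartIntegral_dWedge_eq (o : ManifoldOrientation (𝓡∂ (k + 1)) W)
    {η : DiffForm (𝓡∂ (k + 1)) W k} (hη : η.IsContinuous) (hη' : η.IsClosedInterior)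
    {χ : W → ℝ} (hχ : ContMDiff (𝓡∂ (k + 1)) 𝓘(ℝ, ℝ) ∞ χ) {a : W} (hK : IsCompact (tsupport χ))
    (hs : tsupport χ ⊆ (extChartAt (𝓡∂ (k + 1)) a).source) :
    chartIntegral o (η.dWedge χ) a =
      -∫ z in {z | hyperplaneInclusion k z ∈ (extChartAt (𝓡∂ (k + 1)) a).target},
        χ ((extChartAt (𝓡∂ (k + 1)) a).symm (hyperplaneInclusion k z)) *
          boundaryDensity o η a z := by
  have : IsManifold (𝓡∂ (k + 1)) 1 W := .of_le (n := ∞) (by simp)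
  let φ := extChartAt (𝓡∂ (k + 1)) a
  let T := φ.target
  let K := φ '' tsupport χ
  have hKc : IsCompact K := isCompact_image_extChartAt hK hs
  have hTm : MeasurableSet T := measurableSet_extChartAt_target a
  have hT : T ⊆ {y | 0 ≤ y 0} := extChartAt_target_subset_halfSpace a
  have hKT : K ⊆ T := image_subset_iff.2 fun x hx => φ.map_source (hs hx)
  have hχK : ∀ y ∈ T, y ∉ K → χ (φ.symm y) = 0 := fun y hy hyK =>
    image_eq_zero_of_notMem_tsupport (symm_notMem_of_notMem_image hy hyK)
  -- `χη` in coordinates, multiplied by the orientation sign and extended by zero. It vanishes off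
  -- the compact set `K ⊆ T`, so the extension creates no discontinuity on the half space.
  let ξ : EuclideanSpace ℝ (Fin (k + 1)) → EuclideanSpace ℝ (Fin (k + 1)) [⋀^Fin k]→L[ℝ] ℝ :=
    T.indicator fun y => (chartSign o a y * χ (φ.symm y)) • η.inChart a y
  have hξT : ∀ y ∈ T, ξ y = (chartSign o a y * χ (φ.symm y)) • η.inChart a y := fun y hy =>
    indicator_of_mem hy _
  have hξK : ∀ y, y ∉ K → ξ y = 0 := fun y hyK => by
    by_cases hy : y ∈ T
    · rw [hξT y hy, hχK y hy hyK, mul_zero, zero_smul]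
    · exact indicator_of_notMem hy _
  have hξK' : ∀ y, y ∉ K → ∀ᶠ z in 𝓝 y, ξ z = 0 := fun y hy => by
    filter_upwards [hKc.isClosed.isOpen_compl.mem_nhds hy] with z hz using hξK z hz
  have hc : ContinuousOn ξ {y | 0 ≤ y 0} := by
    intro y hy
    by_cases hyT : y ∈ T
    · have h1 : ContinuousOn (fun y => (chartSign o a y * χ (φ.symm y)) • η.inChart a y) T :=
        ((continuousOn_chartSign o a).mul
          (hχ.continuous.comp_continuousOn (continuousOn_extChartAt_symm a))).smul (hη a)
      have h2 : ContinuousWithinAt ξ T y := (h1 y hyT).congr hξT (hξT y hyT)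
      refine h2.mono_of_mem_nhdsWithin ?_
      rw [← range_modelWithCorners_halfSpace]
      exact extChartAt_target_mem_nhdsWithin_of_mem hyT
    · have h0 := hξK' y fun h => hyT (hKT h)
      exact (continuousAt_const.congr (h0.mono fun z hz => hz.symm)).continuousWithinAt
  have hloc : ∀ y ∈ T, 0 < y 0 → DifferentiableAt ℝ ξ y ∧
      extDeriv ξ y = chartSign o a y • (η.dWedge χ).inChart a y := by
    intro y hy hy0
    have hTn := extChartAt_target_mem_nhds_of_pos hy hy0
    obtain ⟨hd, hcl⟩ := hη' a y (mem_interior_iff_mem_nhds.2 hTn)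
    have hrn : range (𝓡∂ (k + 1)) ∈ 𝓝 y :=
      Filter.mem_of_superset hTn (extChartAt_target_subset_range a)
    have hf : DifferentiableAt ℝ (χ ∘ φ.symm) y := by
      have h1 : ContDiffWithinAt ℝ ∞ (χ ∘ φ.symm) (range (𝓡∂ (k + 1))) y := by
        rw [← contMDiffWithinAt_iff_contDiffWithinAt]
        exact (hχ _).comp_contMDiffWithinAt y (contMDiffWithinAt_extChartAt_symm_range a hy)
      exact (h1.contDiffAt hrn).differentiableAt (by simp)
    -- The sign is locally constant, so it can be frozen at `y` before differentiating.
    have hev : ξ =ᶠ[𝓝 y] fun z => (chartSign o a y * (χ ∘ φ.symm) z) • η.inChart a z := by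
      have h1 := chartSign_eventually_eq o hy
      rw [nhdsWithin_eq_nhds.2 hTn] at h1
      filter_upwards [h1, hTn] with z hz hzT
      rw [hξT z hzT, hz]
      rfl
    refine ⟨((hf.const_mul _).smul hd).congr_of_eventuallyEq hev, ?_⟩
    rw [hev.extDeriv_eq, extDeriv_smul_of_closed hf hd hcl,
      DiffForm.inChart_dWedge η hy (hχ.mdifferentiableAt (by simp)), fderivWithin_of_mem_nhds hrn]
  have hd : ∀ y, 0 < y 0 → DifferentiableAt ℝ ξ y := fun y hy0 => by
    by_cases hy : y ∈ T
    · exact (hloc y hy hy0).1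
    · exact (differentiableAt_const 0).congr_of_eventuallyEq (hξK' y fun h => hy (hKT h))
  have hext : ∀ y, 0 < y 0 → extDeriv ξ y (stdFrame (k + 1)) =
      T.indicator (chartDensity o (η.dWedge χ) a) y := fun y hy0 => by
    by_cases hy : y ∈ T
    · rw [(hloc y hy hy0).2, indicator_of_mem hy, chartDensity_eq]
      rfl
    · rw [extDeriv_eq_zero_of_eventually (hξK' y fun h => hy (hKT h)), indicator_of_notMem hy]
      rfl
  have hms : MeasurableSet {y : EuclideanSpace ℝ (Fin (k + 1)) | 0 ≤ y 0} :=
    (isClosed_le continuous_const (by fun_prop)).measurableSet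
  have hae : ∀ᵐ y : EuclideanSpace ℝ (Fin (k + 1)), y ∈ {y | 0 ≤ y 0} →
      extDeriv ξ y (stdFrame (k + 1)) = T.indicator (chartDensity o (η.dWedge χ) a) y := by
    filter_upwards [ae_apply_zero_ne_zero k] with y hy hy'
    exact hext y (lt_of_le_of_ne hy' hy.symm)
  have hint : IntegrableOn (chartDensity o (η.dWedge χ) a) T :=
    integrableOn_chartDensity o (hη.dWedge hχ) hK hs fun x hx => DiffForm.dWedge_eq_zero η hx
  have hi : IntegrableOn (fun y => extDeriv ξ y (stdFrame (k + 1))) {y | 0 ≤ y 0} := by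
    refine ((integrable_indicator_iff hTm).2 hint).integrableOn.congr_fun_ae ?_
    rw [Filter.EventuallyEq, ae_restrict_iff' hms]
    filter_upwards [hae] with y hy hy' using (hy hy').symm
  obtain ⟨R, hR0, hR⟩ := hKc.isBounded.exists_pos_norm_lt
  have hst := integral_extDeriv_halfSpace hc hd hR0
    (fun y _ hy => hξK y fun h => (hR y h).not_ge hy) hi
  rw [setIntegral_congr_ae hms hae, setIntegral_indicator hTm, inter_eq_right.2 hT] at hst
  rw [chartIntegral, hst]
  have hTm' : MeasurableSet {z | hyperplaneInclusion k z ∈ T} :=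
    hTm.preimage (hyperplaneInclusion k).continuous_of_finiteDimensional.measurable
  rw [← integral_indicator hTm']
  congr 2
  funext z
  by_cases hz : hyperplaneInclusion k z ∈ T
  · rw [indicator_of_mem (s := {z | hyperplaneInclusion k z ∈ T}) hz, hξT _ hz, boundaryDensity,
      ContinuousAlternatingMap.smul_apply, smul_eq_mul]
    ring
  · rw [indicator_of_notMem (s := {z | hyperplaneInclusion k z ∈ T}) hz]
    have : ξ (hyperplaneInclusion k z) = 0 := indicator_of_notMem hz _
    rw [this]
    rfl

end LocalStokes

/-! ### Boundary points, outward vectors and the boundary hyperplane. -/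

section BoundaryCharts

variable {k : ℕ} {W : Type*} [TopologicalSpace W] [ChartedSpace (EuclideanHalfSpace (k + 1)) W]

theorem interior_extChartAt_target_subset (a : W) :
    interior (extChartAt (𝓡∂ (k + 1)) a).target ⊆ {y | 0 < y 0} := by
  rw [← interior_range_modelWithCornersEuclideanHalfSpace]
  exact interior_mono (extChartAt_target_subset_range a)

variable [IsManifold (𝓡∂ (k + 1)) ∞ W]

theorem mem_boundary_iff_extChartAt_zero {a p : W}
    (hp : p ∈ (extChartAt (𝓡∂ (k + 1)) a).source) :
    p ∈ (𝓡∂ (k + 1)).boundary W ↔ extChartAt (𝓡∂ (k + 1)) a p 0 = 0 := by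
  have hy := (extChartAt (𝓡∂ (k + 1)) a).map_source hp
  have h := (𝓡∂ (k + 1)).isBoundaryPoint_iff_of_mem_atlas (n := ∞) (by simp)
    (chart_mem_atlas (EuclideanHalfSpace (k + 1)) a) (by rwa [extChartAt_source] at hp)
  change (𝓡∂ (k + 1)).IsBoundaryPoint p ↔ _
  rw [h]
  change extChartAt (𝓡∂ (k + 1)) a p ∈ frontier (extChartAt (𝓡∂ (k + 1)) a).target ↔ _
  constructor
  · intro hf
    by_contra h0
    exact hf.2 (mem_interior_iff_mem_nhds.2 (extChartAt_target_mem_nhds_of_pos hy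
      (lt_of_le_of_ne (extChartAt_target_subset_halfSpace a hy) (Ne.symm h0))))
  · exact fun h0 => ⟨subset_closure hy, fun hi =>
      (interior_extChartAt_target_subset a hi).ne' h0⟩

/-- `IsOutward` is tested in the chart at `p`, the vector comes from the chart at `a`. The `0`-th
coordinate of the transition map `τ` is nonnegative and zero at `y`, so its derivative `l` there is
nonnegative on the half space. Hence `l` vanishes on the hyperplane (apply this to `v` and `-v`); it
is nonzero because `τ` has surjective derivative, so `l` is positive on `∂₀`. -/
theorem isOutward_neg_chartSymmDeriv {a p : W} (hp : p ∈ (extChartAt (𝓡∂ (k + 1)) a).source)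
    (hb : p ∈ (𝓡∂ (k + 1)).boundary W) :
    IsOutward p (-(chartSymmDeriv (𝓡∂ (k + 1)) a (extChartAt (𝓡∂ (k + 1)) a p)
      (stdFrame (k + 1) 0)) : EuclideanSpace ℝ (Fin (k + 1))) := by
  have : IsManifold (𝓡∂ (k + 1)) 1 W := .of_le (n := ∞) (by simp)
  let y := extChartAt (𝓡∂ (k + 1)) a p
  have hy : y ∈ (extChartAt (𝓡∂ (k + 1)) a).target := (extChartAt (𝓡∂ (k + 1)) a).map_source hp
  have hyp : (extChartAt (𝓡∂ (k + 1)) a).symm y = p := (extChartAt (𝓡∂ (k + 1)) a).left_inv hp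
  let τ := inCharts (𝓡∂ (k + 1)) (𝓡∂ (k + 1)) a p (id : W → W)
  have hy' : id ((extChartAt (𝓡∂ (k + 1)) a).symm y) ∈ (extChartAt (𝓡∂ (k + 1)) p).source := by
    rw [hyp]; exact mem_extChartAt_source p
  let A := mfderivModel 𝓘(ℝ, EuclideanSpace ℝ (Fin (k + 1))) (𝓡∂ (k + 1))
    (extChartAt (𝓡∂ (k + 1)) p) p
  let D := chartSymmDeriv (𝓡∂ (k + 1)) a y
  have hyr : y ∈ range (𝓡∂ (k + 1)) := extChartAt_target_subset_range a hy
  have hτ' : fderivWithin ℝ τ (range (𝓡∂ (k + 1))) y = A.comp D := by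
    rw [← mfderivWithin_eq_fderivWithin]
    have h1 : MDifferentiableAt (𝓡∂ (k + 1)) 𝓘(ℝ, EuclideanSpace ℝ (Fin (k + 1)))
        (extChartAt (𝓡∂ (k + 1)) p) ((extChartAt (𝓡∂ (k + 1)) a).symm y) :=
      mdifferentiableAt_extChartAt (by rw [hyp]; exact mem_chart_source _ p)
    refine (mfderiv_comp_mfderivWithin y h1 (mdifferentiableWithinAt_extChartAt_symm hy)
      ((𝓡∂ (k + 1)).uniqueMDiffOn _ hyr)).trans ?_
    have h2 : mfderivModel 𝓘(ℝ, EuclideanSpace ℝ (Fin (k + 1))) (𝓡∂ (k + 1))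
      (extChartAt (𝓡∂ (k + 1)) p) ((extChartAt (𝓡∂ (k + 1)) a).symm y) = A := by rw [hyp]
    rw [← h2]
    rfl
  have hA : Function.Surjective A :=
    (isInvertible_mfderiv_extChartAt (I := 𝓡∂ (k + 1)) (mem_extChartAt_source p)).surjective
  have hD : Function.Surjective D :=
    (isInvertible_mfderivWithin_extChartAt_symm (I := 𝓡∂ (k + 1)) hy).surjective
  have hd : HasFDerivWithinAt τ (A.comp D) {y | 0 ≤ y 0} y := by
    rw [← hτ', ← range_modelWithCorners_halfSpace]
    exact ((contDiffWithinAt_inCharts contMDiff_id hy hy').differentiableWithinAt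
      (by simp)).hasFDerivWithinAt
  let P : EuclideanSpace ℝ (Fin (k + 1)) →L[ℝ] ℝ := EuclideanSpace.proj 0
  have hd0 : HasFDerivWithinAt (fun z => τ z 0) (P.comp (A.comp D)) {y | 0 ≤ y 0} y :=
    P.hasFDerivAt.comp_hasFDerivWithinAt y hd
  have hτ0 : ∀ z, 0 ≤ τ z 0 := fun z => by
    have : τ z ∈ range (𝓡∂ (k + 1)) := mem_range_self _
    rwa [range_modelWithCorners_halfSpace] at this
  have hτy : τ y 0 = 0 := by
    have h1 := (mem_boundary_iff_extChartAt_zero (mem_extChartAt_source p)).1 hb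
    simp only [τ, inCharts, id, hyp]
    exact h1
  have hy0 : y 0 = 0 := (mem_boundary_iff_extChartAt_zero hp).1 hb
  have hmin : IsLocalMinOn (fun z => τ z 0) {y | 0 ≤ y 0} y :=
    Filter.Eventually.of_forall fun z => by simpa [hτy] using hτ0 z
  let l : EuclideanSpace ℝ (Fin (k + 1)) →L[ℝ] ℝ := P.comp (A.comp D)
  have hnn : ∀ v : EuclideanSpace ℝ (Fin (k + 1)), 0 ≤ v 0 → 0 ≤ l v := by
    intro v hv
    refine hmin.hasFDerivWithinAt_nonneg hd0 (mem_posTangentConeAt_of_segment_subset ?_)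
    refine (convex_halfSpace_ge (𝕜 := ℝ) P.toLinearMap.isLinear 0).segment_subset ?_ ?_
    · exact hy0.ge
    · change 0 ≤ (y + v) 0
      simpa [hy0] using hv
  have hl : ∀ v : EuclideanSpace ℝ (Fin (k + 1)), l v = v 0 * l (stdFrame (k + 1) 0) := by
    intro v
    have e : (v - v 0 • stdFrame (k + 1) 0) 0 = 0 := by simp [stdFrame]
    have h1 := hnn (v - v 0 • stdFrame (k + 1) 0) e.ge
    have h2 := hnn (-(v - v 0 • stdFrame (k + 1) 0)) (by rw [PiLp.neg_apply, e, neg_zero])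
    rw [map_neg] at h2
    have h3 : l (v - v 0 • stdFrame (k + 1) 0) = 0 := by linarith
    rw [map_sub, map_smul, smul_eq_mul] at h3
    linarith
  obtain ⟨v, hv⟩ := hA (stdFrame (k + 1) 0)
  obtain ⟨w, rfl⟩ := hD v
  have hw : l w = 1 := by
    change P (A (D w)) = 1
    rw [hv]; simp [P, stdFrame]
  have hpos : 0 < l (stdFrame (k + 1) 0) := by
    refine lt_of_le_of_ne (hnn _ (by simp [stdFrame])) fun h => ?_
    rw [hl, ← h, mul_zero] at hw
    exact zero_ne_one hw
  change (A (-(D (stdFrame (k + 1) 0)))) 0 < 0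
  rw [map_neg, PiLp.neg_apply]
  exact neg_neg_of_pos hpos

theorem hyperplaneInclusion_stdFrame (i : Fin k) :
    hyperplaneInclusion k (stdFrame k i) = stdFrame (k + 1) i.succ := by
  ext l
  refine Fin.cases ?_ (fun l => ?_) l
  · simp [stdFrame, Fin.succ_ne_zero]
  · simp [stdFrame]

/-- The projection forgetting the `0`-th coordinate. -/
noncomputable def hyperplaneProjection (k : ℕ) :
    EuclideanSpace ℝ (Fin (k + 1)) →L[ℝ] EuclideanSpace ℝ (Fin k) :=
  LinearMap.toContinuousLinearMap
    { toFun := fun y => WithLp.toLp 2 (Fin.tail y.ofLp)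
      map_add' := fun _ _ => rfl
      map_smul' := fun _ _ => rfl }

theorem hyperplaneInclusion_projection {y : EuclideanSpace ℝ (Fin (k + 1))} (hy : y 0 = 0) :
    hyperplaneInclusion k (hyperplaneProjection k y) = y := by
  ext l
  refine Fin.cases ?_ (fun l => ?_) l
  · exact hy.symm
  · rfl

/-- In the expansion along the first column, `-1` is the only nonzero entry; this is the sign of the
boundary orientation. -/
theorem det_cons_neg_hyperplaneInclusion
    (A : EuclideanSpace ℝ (Fin k) →L[ℝ] EuclideanSpace ℝ (Fin k)) :
    (EuclideanSpace.basisFun (Fin (k + 1)) ℝ).toBasis.det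
      (Fin.cons (-stdFrame (k + 1) 0) fun i => hyperplaneInclusion k (A (stdFrame k i))) =
      -A.det := by
  rw [← det_stdBasis_comp, Basis.det_apply, Basis.det_apply, Matrix.det_succ_column_zero,
    Finset.sum_eq_single 0]
  · have : ((EuclideanSpace.basisFun (Fin (k + 1)) ℝ).toBasis.toMatrix (Fin.cons
        (-stdFrame (k + 1) 0) fun i => hyperplaneInclusion k (A (stdFrame k i)))).submatrix
        (Fin.succAbove 0) Fin.succ =
        (EuclideanSpace.basisFun (Fin k) ℝ).toBasis.toMatrix fun i => A (stdFrame k i) := by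
      ext i l
      simp [Basis.toMatrix_apply]
    rw [this]
    simp [Basis.toMatrix_apply, stdFrame]
  · intro i _ hi
    simp [Basis.toMatrix_apply, stdFrame, hi]
  · simp

/-- Restricted to the hyperplane, `α` has top degree, hence is a multiple of the determinant. -/
theorem apply_hyperplaneInclusion
    (α : EuclideanSpace ℝ (Fin (k + 1)) [⋀^Fin k]→L[ℝ] ℝ)
    (A : EuclideanSpace ℝ (Fin k) →L[ℝ] EuclideanSpace ℝ (Fin k)) :
    α (fun i => hyperplaneInclusion k (A (stdFrame k i))) =
      A.det * α fun i => stdFrame (k + 1) i.succ := by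
  have h := DFunLike.congr_fun (AlternatingMap.eq_smul_basis_det
    (EuclideanSpace.basisFun (Fin k) ℝ).toBasis
    (α.toAlternatingMap.compLinearMap (hyperplaneInclusion k))) (fun i => A (stdFrame k i))
  rw [AlternatingMap.smul_apply, det_stdBasis_comp, AlternatingMap.compLinearMap_apply,
    AlternatingMap.compLinearMap_apply] at h
  have e : (fun i => hyperplaneInclusion k ((EuclideanSpace.basisFun (Fin k) ℝ).toBasis i)) =
      fun i => stdFrame (k + 1) i.succ := by
    funext i
    rw [← hyperplaneInclusion_stdFrame]
    simp [stdFrame]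
  rw [mul_comm, ← e]
  exact h

end BoundaryCharts

/-! ### Integrals over the boundary as hyperplane integrals. -/

section BoundaryIntegral

variable {k : ℕ} {W : Type*} [TopologicalSpace W] [ChartedSpace (EuclideanHalfSpace (k + 1)) W]
  {N : Type*} [TopologicalSpace N] [ChartedSpace (EuclideanSpace ℝ (Fin k)) N]

/-- The map `j` into the boundary, in the preferred charts at `x₀` and `a`. -/
noncomputable def boundaryInCharts (j : N → W) (x₀ : N) (a : W) (u : EuclideanSpace ℝ (Fin k)) :
    EuclideanSpace ℝ (Fin k) :=
  hyperplaneProjection k (inCharts (𝓡∂ (k + 1)) (𝓡 k) x₀ a j u)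

/-- The part of the chart at `x₀` which `j` maps to the chart at `a`. -/
def boundaryChartDomain (j : N → W) (x₀ : N) (a : W) : Set (EuclideanSpace ℝ (Fin k)) :=
  {u | u ∈ (extChartAt (𝓡 k) x₀).target ∧
    j ((extChartAt (𝓡 k) x₀).symm u) ∈ (extChartAt (𝓡∂ (k + 1)) a).source}

variable {j : N → W} {x₀ : N} {a : W} {u : EuclideanSpace ℝ (Fin k)}

theorem measurableSet_hyperplane_target (a : W) :
    MeasurableSet {z | hyperplaneInclusion k z ∈ (extChartAt (𝓡∂ (k + 1)) a).target} :=
  (measurableSet_extChartAt_target a).preimage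
    (hyperplaneInclusion k).continuous_of_finiteDimensional.measurable

theorem boundaryChartDomain_mem_nhds (hj : Continuous j) (hu : u ∈ boundaryChartDomain j x₀ a) :
    boundaryChartDomain j x₀ a ∈ 𝓝 u := by
  have h := eventually_mem_source_inCharts (I := 𝓡∂ (k + 1)) (J := 𝓡 k) hj hu.1 hu.2
  rwa [ModelWithCorners.range_eq_univ, nhdsWithin_univ] at h

variable [IsManifold (𝓡∂ (k + 1)) ∞ W]

theorem hyperplaneInclusion_boundaryInCharts (hb : ∀ x, j x ∈ (𝓡∂ (k + 1)).boundary W)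
    (hu : u ∈ boundaryChartDomain j x₀ a) :
    hyperplaneInclusion k (boundaryInCharts j x₀ a u) =
      inCharts (𝓡∂ (k + 1)) (𝓡 k) x₀ a j u :=
  hyperplaneInclusion_projection ((mem_boundary_iff_extChartAt_zero hu.2).1 (hb _))

theorem symm_hyperplaneInclusion_boundaryInCharts (hb : ∀ x, j x ∈ (𝓡∂ (k + 1)).boundary W)
    (hu : u ∈ boundaryChartDomain j x₀ a) :
    (extChartAt (𝓡∂ (k + 1)) a).symm (hyperplaneInclusion k (boundaryInCharts j x₀ a u)) =
      j ((extChartAt (𝓡 k) x₀).symm u) := by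
  rw [hyperplaneInclusion_boundaryInCharts hb hu]
  exact (extChartAt (𝓡∂ (k + 1)) a).left_inv hu.2

theorem injOn_boundaryInCharts (hinj : Function.Injective j)
    (hb : ∀ x, j x ∈ (𝓡∂ (k + 1)).boundary W) :
    InjOn (boundaryInCharts (k := k) j x₀ a) (boundaryChartDomain j x₀ a) := by
  intro u hu v hv huv
  have h1 := symm_hyperplaneInclusion_boundaryInCharts hb hu
  rw [huv, symm_hyperplaneInclusion_boundaryInCharts hb hv] at h1
  exact (extChartAt (𝓡 k) x₀).symm.injOn hu.1 hv.1 (hinj h1).symm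

theorem image_boundaryChartDomain (hb : ∀ x, j x ∈ (𝓡∂ (k + 1)).boundary W) :
    boundaryInCharts j x₀ a '' boundaryChartDomain j x₀ a =
      {z | hyperplaneInclusion k z ∈ (extChartAt (𝓡∂ (k + 1)) a).target ∧
        (extChartAt (𝓡∂ (k + 1)) a).symm (hyperplaneInclusion k z) ∈
          j '' (extChartAt (𝓡 k) x₀).source} := by
  ext z
  constructor
  · rintro ⟨u, hu, rfl⟩
    refine ⟨?_, ?_⟩
    · rw [hyperplaneInclusion_boundaryInCharts hb hu]
      exact (extChartAt (𝓡∂ (k + 1)) a).map_source hu.2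
    · rw [symm_hyperplaneInclusion_boundaryInCharts hb hu]
      exact ⟨_, (extChartAt (𝓡 k) x₀).map_target hu.1, rfl⟩
  · rintro ⟨hz, x, hx, hxz⟩
    have hx' : (extChartAt (𝓡 k) x₀).symm (extChartAt (𝓡 k) x₀ x) = x :=
      (extChartAt (𝓡 k) x₀).left_inv hx
    refine ⟨extChartAt (𝓡 k) x₀ x, ⟨(extChartAt (𝓡 k) x₀).map_source hx, ?_⟩, ?_⟩
    · rw [hx', hxz]
      exact (extChartAt (𝓡∂ (k + 1)) a).map_target hz
    · rw [boundaryInCharts, inCharts, hx', hxz, (extChartAt (𝓡∂ (k + 1)) a).right_inv hz]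
      rfl

variable [IsManifold (𝓡 k) ∞ N]

theorem hasFDerivAt_inCharts (hj : ContMDiff (𝓡 k) (𝓡∂ (k + 1)) ∞ j)
    (hu : u ∈ boundaryChartDomain j x₀ a) :
    HasFDerivAt (inCharts (𝓡∂ (k + 1)) (𝓡 k) x₀ a j)
      (fderiv ℝ (inCharts (𝓡∂ (k + 1)) (𝓡 k) x₀ a j) u) u := by
  have h := (contDiffWithinAt_inCharts hj hu.1 hu.2).differentiableWithinAt (by simp)
  rw [ModelWithCorners.range_eq_univ, differentiableWithinAt_univ] at h
  exact h.hasFDerivAt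

theorem hasFDerivAt_boundaryInCharts (hj : ContMDiff (𝓡 k) (𝓡∂ (k + 1)) ∞ j)
    (hu : u ∈ boundaryChartDomain j x₀ a) :
    HasFDerivAt (boundaryInCharts j x₀ a) (fderiv ℝ (boundaryInCharts j x₀ a) u) u :=
  ((hyperplaneProjection k).hasFDerivAt.comp u
    (hasFDerivAt_inCharts hj hu)).differentiableAt.hasFDerivAt

/-- `j` takes values in the boundary, so near `u` its coordinate expression stays in the hyperplane.
-/
theorem fderiv_inCharts_eq (hj : ContMDiff (𝓡 k) (𝓡∂ (k + 1)) ∞ j)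
    (hb : ∀ x, j x ∈ (𝓡∂ (k + 1)).boundary W) (hu : u ∈ boundaryChartDomain j x₀ a)
    (v : EuclideanSpace ℝ (Fin k)) :
    fderiv ℝ (inCharts (𝓡∂ (k + 1)) (𝓡 k) x₀ a j) u v =
      hyperplaneInclusion k (fderiv ℝ (boundaryInCharts j x₀ a) u v) := by
  have h1 : inCharts (𝓡∂ (k + 1)) (𝓡 k) x₀ a j =ᶠ[𝓝 u]
      fun z => (hyperplaneInclusion k).toContinuousLinearMap (boundaryInCharts j x₀ a z) := by
    filter_upwards [boundaryChartDomain_mem_nhds hj.continuous hu] with z hz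
    exact (hyperplaneInclusion_boundaryInCharts hb hz).symm
  have h2 := ((hyperplaneInclusion k).toContinuousLinearMap.hasFDerivAt.comp u
    (hasFDerivAt_boundaryInCharts hj hu)).fderiv
  rw [h1.fderiv_eq]
  exact DFunLike.congr_fun h2 v

/-- `j` is compatible with the orientations of `N` and of the boundary of `W`, for the convention
"outward vector first". -/
def IsBoundaryOriented (oW : ManifoldOrientation (𝓡∂ (k + 1)) W)
    (oN : ManifoldOrientation (𝓡 k) N) (j : N → W) : Prop :=
  ∀ (x : N) (ν : TangentSpace (𝓡∂ (k + 1)) (j x)), IsOutward (j x) ν →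
    ∀ v : Fin k → TangentSpace (𝓡 k) x,
      IsPositiveFrame (oN.toFun x) v ↔
        IsPositiveFrame (oW.toFun (j x))
          (Fin.cons ν fun a => mfderiv (𝓡 k) (𝓡∂ (k + 1)) j x (v a) :
            Fin (k + 1) → TangentSpace (𝓡∂ (k + 1)) (j x))

variable {oW : ManifoldOrientation (𝓡∂ (k + 1)) W} {oN : ManifoldOrientation (𝓡 k) N}

/-- The orientation condition is applied to the outward vector `-∂₀` of the chart at `a`. Relative
to the coordinate frame there, `(-∂₀, dj ∂₁, …)` has determinant `-det A`. -/
theorem chartSign_mul_det_boundary (hj : ContMDiff (𝓡 k) (𝓡∂ (k + 1)) ∞ j)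
    (hb : ∀ x, j x ∈ (𝓡∂ (k + 1)).boundary W) (ho : IsBoundaryOriented oW oN j)
    (hu : u ∈ boundaryChartDomain j x₀ a) :
    chartSign oN x₀ u * (fderiv ℝ (boundaryInCharts j x₀ a) u).det =
      -(chartSign oW a (hyperplaneInclusion k (boundaryInCharts j x₀ a u)) *
        |(fderiv ℝ (boundaryInCharts j x₀ a) u).det|) := by
  have : IsManifold (𝓡∂ (k + 1)) 1 W := .of_le (n := ∞) (by simp)
  have : IsManifold (𝓡 k) 1 N := .of_le (n := ∞) (by simp)
  set A := fderiv ℝ (boundaryInCharts j x₀ a) u with hA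
  let x := (extChartAt (𝓡 k) x₀).symm u
  let y := inCharts (𝓡∂ (k + 1)) (𝓡 k) x₀ a j u
  let D := chartSymmDeriv (𝓡∂ (k + 1)) a y
  let oN' : N → Orientation ℝ (EuclideanSpace ℝ (Fin k)) (Fin k) := oN.toFun
  let oW' : W → Orientation ℝ (EuclideanSpace ℝ (Fin (k + 1))) (Fin (k + 1)) := oW.toFun
  have hy : y ∈ (extChartAt (𝓡∂ (k + 1)) a).target :=
    (extChartAt (𝓡∂ (k + 1)) a).map_source hu.2
  have hpos : IsPositiveFrame (oN' x) (fun i => chartSymmDeriv (𝓡 k) x₀ u (stdFrame k i)) ↔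
      IsPositiveFrame (oW' (j x)) (Fin.cons (-(D (stdFrame (k + 1) 0))) fun i =>
        mfderivModel (𝓡∂ (k + 1)) (𝓡 k) j x (chartSymmDeriv (𝓡 k) x₀ u (stdFrame k i))) :=
    ho x _ (isOutward_neg_chartSymmDeriv hu.2 (hb x)) _
  have hk := chartSymmDeriv_comp_fderivWithin (I := 𝓡∂ (k + 1)) (J := 𝓡 k) hu.1 hu.2
    (hj.mdifferentiableAt (by simp))
  have hk' : ∀ v, mfderivModel (𝓡∂ (k + 1)) (𝓡 k) j x (chartSymmDeriv (𝓡 k) x₀ u v) =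
      D (hyperplaneInclusion k (A v)) := by
    intro v
    rw [hA, ← fderiv_inCharts_eq hj hb hu, ← fderivWithin_univ,
      ← (𝓡 k).range_eq_univ]
    exact (DFunLike.congr_fun hk v).symm
  obtain ⟨e, he⟩ : D.IsInvertible := isInvertible_mfderivWithin_extChartAt_symm (I := 𝓡∂ (k + 1)) hy
  let b := (EuclideanSpace.basisFun (Fin (k + 1)) ℝ).toBasis.map e.toLinearEquiv
  have hbD : ⇑b = fun i => D (stdFrame (k + 1) i) := by
    funext i
    rw [← he]
    simp [b, stdFrame]
  let w : Fin (k + 1) → EuclideanSpace ℝ (Fin (k + 1)) :=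
    Fin.cons (-stdFrame (k + 1) 0) fun i => hyperplaneInclusion k (A (stdFrame k i))
  have hw : (Fin.cons (-(D (stdFrame (k + 1) 0))) fun i =>
        mfderivModel (𝓡∂ (k + 1)) (𝓡 k) j x (chartSymmDeriv (𝓡 k) x₀ u (stdFrame k i))) =
      fun i => D (w i) := by
    funext i
    refine Fin.cases ?_ (fun i => ?_) i
    · simp [w]
    · simp [w, hk']
  have hdet : b.det (fun i => D (w i)) = -A.det := by
    rw [Basis.det_map, ← det_cons_neg_hyperplaneInclusion]
    congr 1
    funext i
    rw [← he]
    simp [w]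
  rw [hw] at hpos
  have h1 := frameSign_mul_det (oW' (j x)) b (fun i => D (w i))
  rw [hdet, abs_neg, ← frameSign_congr hpos, hbD] at h1
  have h2 : chartSign oW a (hyperplaneInclusion k (boundaryInCharts j x₀ a u)) =
      frameSign (oW' (j x)) (fun i => D (stdFrame (k + 1) i)) := by
    have h3 : (extChartAt (𝓡∂ (k + 1)) a).symm y = j x :=
      (extChartAt (𝓡∂ (k + 1)) a).left_inv hu.2
    rw [hyperplaneInclusion_boundaryInCharts hb hu, ← h3]
    rfl
  rw [h2, ← h1]
  have h4 : chartSign oN x₀ u =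
    frameSign (oN' x) (fun i => chartSymmDeriv (𝓡 k) x₀ u (stdFrame k i)) := rfl
  rw [h4]
  ring

theorem chartDensity_pullback_boundary (hj : ContMDiff (𝓡 k) (𝓡∂ (k + 1)) ∞ j)
    (hb : ∀ x, j x ∈ (𝓡∂ (k + 1)).boundary W) (ho : IsBoundaryOriented oW oN j)
    (η : DiffForm (𝓡∂ (k + 1)) W k) (hu : u ∈ boundaryChartDomain j x₀ a) :
    chartDensity oN (η.pullback j) x₀ u = |(fderiv ℝ (boundaryInCharts j x₀ a) u).det| *
      -boundaryDensity oW η a (boundaryInCharts j x₀ a u) := by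
  have : IsManifold (𝓡∂ (k + 1)) 1 W := .of_le (n := ∞) (by simp)
  have : IsManifold (𝓡 k) 1 N := .of_le (n := ∞) (by simp)
  rw [chartDensity_eq, η.inChart_pullback hu.1 hu.2 (hj.mdifferentiableAt (by simp)),
    (𝓡 k).range_eq_univ, fderivWithin_univ,
    ContinuousAlternatingMap.compContinuousLinearMap_apply]
  have e : ⇑(fderiv ℝ (inCharts (𝓡∂ (k + 1)) (𝓡 k) x₀ a j) u) ∘ stdFrame k =
      fun i => hyperplaneInclusion k (fderiv ℝ (boundaryInCharts j x₀ a) u (stdFrame k i)) :=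
    funext fun i => fderiv_inCharts_eq hj hb hu _
  rw [e, apply_hyperplaneInclusion, ← mul_assoc, chartSign_mul_det_boundary hj hb ho hu,
    boundaryDensity, hyperplaneInclusion_boundaryInCharts hb hu]
  ring

/-- Change of variables along `j` in charts; the vanishing conditions on `q` confine both integrals
to the common domain. No continuity of `q` on `W` is required, so integrability on the hyperplane is
also carried over from `N`. -/
theorem chartIntegral_boundary (hj : ContMDiff (𝓡 k) (𝓡∂ (k + 1)) ∞ j)
    (hinj : Function.Injective j)
    (hb : ∀ x, j x ∈ (𝓡∂ (k + 1)).boundary W) (ho : IsBoundaryOriented oW oN j)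
    (η : DiffForm (𝓡∂ (k + 1)) W k) {q : W → ℝ}
    (hq : ∀ x, x ∉ (extChartAt (𝓡∂ (k + 1)) a).source → q x = 0)
    (hq' : ∀ x, x ∉ j '' (extChartAt (𝓡 k) x₀).source → q x = 0)
    (hi : IntegrableOn (chartDensity oN ((η.pullback j).smulFun (q ∘ j)) x₀)
      (extChartAt (𝓡 k) x₀).target) :
    IntegrableOn (fun z => q ((extChartAt (𝓡∂ (k + 1)) a).symm (hyperplaneInclusion k z)) *
        boundaryDensity oW η a z)
      {z | hyperplaneInclusion k z ∈ (extChartAt (𝓡∂ (k + 1)) a).target} ∧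
    chartIntegral oN ((η.pullback j).smulFun (q ∘ j)) x₀ =
      -∫ z in {z | hyperplaneInclusion k z ∈ (extChartAt (𝓡∂ (k + 1)) a).target},
        q ((extChartAt (𝓡∂ (k + 1)) a).symm (hyperplaneInclusion k z)) *
          boundaryDensity oW η a z := by
  let S := boundaryChartDomain (k := k) j x₀ a
  let τ := boundaryInCharts (k := k) j x₀ a
  let G : EuclideanSpace ℝ (Fin k) → ℝ := fun z =>
    q ((extChartAt (𝓡∂ (k + 1)) a).symm (hyperplaneInclusion k z)) * boundaryDensity oW η a z
  have hSm : MeasurableSet S :=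
    measurableSet_target_inter_preimage hj.continuous (isOpen_extChartAt_source a) x₀
  have hder : ∀ u ∈ S, HasFDerivWithinAt τ (fderiv ℝ τ u) S u := fun u hu =>
    (hasFDerivAt_boundaryInCharts hj hu).hasFDerivWithinAt
  have hτ : InjOn τ S := injOn_boundaryInCharts hinj hb
  have hdens : ∀ u ∈ S, chartDensity oN ((η.pullback j).smulFun (q ∘ j)) x₀ u =
      -(|(fderiv ℝ τ u).det| • G (τ u)) := by
    intro u hu
    rw [chartDensity_smulFun, chartDensity_pullback_boundary hj hb ho η hu]
    simp only [G, τ, symm_hyperplaneInclusion_boundaryInCharts hb hu, Function.comp_apply,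
      smul_eq_mul]
    ring
  have himg : τ '' S ⊆ {z | hyperplaneInclusion k z ∈ (extChartAt (𝓡∂ (k + 1)) a).target} := by
    rw [image_boundaryChartDomain hb]
    exact fun z hz => hz.1
  have hG0 : ∀ z ∈ {z | hyperplaneInclusion k z ∈ (extChartAt (𝓡∂ (k + 1)) a).target} \ τ '' S,
      G z = 0 := by
    rintro z ⟨hz, hzS⟩
    rw [image_boundaryChartDomain hb] at hzS
    simp only [G]
    rw [hq' _ fun h => hzS ⟨hz, h⟩, zero_mul]
  constructor
  · refine IntegrableOn.of_forall_sdiff_eq_zero (s := τ '' S) ?_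
      (measurableSet_hyperplane_target a) hG0
    rw [integrableOn_image_iff_integrableOn_abs_det_fderiv_smul _ hSm hder hτ]
    refine IntegrableOn.congr_fun (hi.mono_set fun u hu => hu.1).neg (fun u hu => ?_) hSm
    rw [Pi.neg_apply, hdens u hu, neg_neg]
  · rw [setIntegral_eq_of_subset_of_forall_sdiff_eq_zero (measurableSet_hyperplane_target a)
      himg hG0, integral_image_eq_integral_abs_det_fderiv_smul _ hSm hder hτ, ← integral_neg,
      ← setIntegral_congr_fun hSm hdens]
    refine setIntegral_eq_of_subset_of_forall_sdiff_eq_zero (measurableSet_extChartAt_target x₀)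
      (fun u hu => hu.1) fun u hu => ?_
    rw [chartDensity_smulFun, Function.comp_apply, hq _ fun h => hu.2 ⟨hu.1, h⟩, zero_mul]

end BoundaryIntegral

/-! ### Stokes' theorem for closed forms. -/

section Stokes

variable {k : ℕ} {W : Type*} [TopologicalSpace W] [ChartedSpace (EuclideanHalfSpace (k + 1)) W]
  {N : Type*} [TopologicalSpace N] [ChartedSpace (EuclideanSpace ℝ (Fin k)) N]

/-- Transports partitions of unity to the union of the images; by disjointness only one `i`
contributes at each point. -/
theorem sum_extend_eq_one {ι X Y : Type*} [Fintype ι] {j : ι → X → Y}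
    (hinj : ∀ i, Function.Injective (j i))
    (hdisj : Pairwise fun i i' => Disjoint (range (j i)) (range (j i'))) {s : Finset X}
    {ρ : X → X → ℝ} (hρ : ∀ x, ∑ x₀ ∈ s, ρ x₀ x = 1) {w : Y} (hw : w ∈ ⋃ i, range (j i)) :
    ∑ i, ∑ x₀ ∈ s, Function.extend (j i) (ρ x₀) 0 w = 1 := by
  obtain ⟨i, x, rfl⟩ := mem_iUnion.1 hw
  rw [Finset.sum_eq_single i]
  · simp only [(hinj i).extend_apply, hρ]
  · intro i' _ hi'
    refine Finset.sum_eq_zero fun x₀ _ => ?_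
    rw [Function.extend_apply' _ _ _ fun ⟨y, hy⟩ =>
      (disjoint_left.1 (hdisj hi')) ⟨y, rfl⟩ ⟨x, hy.symm⟩]
    rfl
  · simp

/-- **Stokes' theorem** for a closed form on a compact oriented manifold with boundary. -/
theorem sum_integralForm_boundary_eq_zero
    [IsManifold (𝓡∂ (k + 1)) ∞ W] [T2Space W] [CompactSpace W]
    [IsManifold (𝓡 k) ∞ N] [T2Space N] [CompactSpace N] {ι : Type*} [Fintype ι]
    {oW : ManifoldOrientation (𝓡∂ (k + 1)) W} {oN : ι → ManifoldOrientation (𝓡 k) N}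
    {j : ι → N → W} (h : IsOrientedBoundary oW oN j) {η : DiffForm (𝓡∂ (k + 1)) W k}
    (hη : η.IsContinuous) (hη' : η.IsClosedInterior) :
    ∑ i, integralForm (oN i) (η.pullback (j i)) = 0 := by
  obtain ⟨s, hs0, hs1⟩ := (chartPartition (𝓡 k) N).exists_finset
  obtain ⟨t, -, ht1⟩ := (chartPartition (𝓡∂ (k + 1)) W).exists_finset
  let χ := chartPartition (𝓡∂ (k + 1)) W
  let ρ := chartPartition (𝓡 k) N
  have hj : ∀ i, ContMDiff (𝓡 k) (𝓡∂ (k + 1)) ∞ (j i) := fun i => (h.isSmoothEmbedding i).contMDiff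
  have hinj : ∀ i, Function.Injective (j i) := fun i => (h.isSmoothEmbedding i).isEmbedding.injective
  have hb : ∀ i x, j i x ∈ (𝓡∂ (k + 1)).boundary W := fun i x => by
    rw [← h.iUnion_range]
    exact mem_iUnion.2 ⟨i, x, rfl⟩
  -- Both partitions at once: the one on `N`, carried to `j i` and extended by zero, times the one
  -- on `W`. It need not be continuous on `W`, but its composition with `j i` is.
  let q : ι → N → W → W → ℝ := fun i x₀ a w => Function.extend (j i) (ρ x₀) 0 w * χ a w
  have hqj : ∀ i x₀ a x, q i x₀ a (j i x) = ρ x₀ x * χ a (j i x) := fun i x₀ a x => by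
    simp only [q, (hinj i).extend_apply]
  let G : W → EuclideanSpace ℝ (Fin k) → W := fun a z =>
    (extChartAt (𝓡∂ (k + 1)) a).symm (hyperplaneInclusion k z)
  let B : W → Set (EuclideanSpace ℝ (Fin k)) := fun a =>
    {z | hyperplaneInclusion k z ∈ (extChartAt (𝓡∂ (k + 1)) a).target}
  have hi : ∀ i x₀ a, IntegrableOn
      (chartDensity (oN i) ((η.pullback (j i)).smulFun (q i x₀ a ∘ j i)) x₀)
      (extChartAt (𝓡 k) x₀).target := by
    intro i x₀ a
    have hc : Continuous (q i x₀ a ∘ j i) := by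
      have : q i x₀ a ∘ j i = fun x => ρ x₀ x * χ a (j i x) := funext (hqj i x₀ a)
      rw [this]
      exact (ρ x₀).2.continuous.mul ((χ a).2.continuous.comp (hj i).continuous)
    refine integrableOn_chartDensity (oN i) ((hη.pullback (hj i)).smulFun hc)
      (isCompact_tsupport_chartPartition x₀) (tsupport_chartPartition_subset x₀) fun x hx => ?_
    rw [DiffForm.smulFun, Function.comp_apply, hqj, image_eq_zero_of_notMem_tsupport hx, zero_mul,
      zero_smul]
  have hcb : ∀ i x₀ a, _ := fun i x₀ a =>
    chartIntegral_boundary (a := a) (x₀ := x₀) (hj i) (hinj i) (hb i) (h.orientation i) η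
      (q := q i x₀ a)
      (fun w hw => by
        simp only [q]
        rw [image_eq_zero_of_notMem_tsupport (f := χ a)
          fun hw' => hw (tsupport_chartPartition_subset a hw'), mul_zero])
      (fun w hw => by
        simp only [q]
        by_cases hw' : ∃ x, j i x = w
        · obtain ⟨x, rfl⟩ := hw'
          rw [(hinj i).extend_apply, image_eq_zero_of_notMem_tsupport (f := ρ x₀)
            fun hx => hw ⟨x, tsupport_chartPartition_subset x₀ hx, rfl⟩, zero_mul]
        · rw [Function.extend_apply' _ _ _ hw', Pi.zero_apply, zero_mul])
      (hi i x₀ a)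
  have h1 : ∀ i, integralForm (oN i) (η.pullback (j i)) = ∑ a ∈ t, ∑ x₀ ∈ s,
      -∫ z in B a, q i x₀ a (G a z) * boundaryDensity oW η a z := by
    intro i
    rw [integralForm_eq_sum (oN i) _ hs0, Finset.sum_comm]
    refine Finset.sum_congr rfl fun x₀ _ => ?_
    have e : (η.pullback (j i) : DiffForm (𝓡 k) N k).smulFun (ρ x₀) =
        ∑ a ∈ t, (η.pullback (j i) : DiffForm (𝓡 k) N k).smulFun (q i x₀ a ∘ j i) := by
      funext x
      rw [Finset.sum_apply]
      simp only [DiffForm.smulFun, Function.comp_apply, hqj]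
      rw [← Finset.sum_smul, ← Finset.mul_sum, ht1, mul_one]
    rw [e, chartIntegral_sum _ _ _ _ fun a _ => hi i x₀ a]
    exact Finset.sum_congr rfl fun a _ => (hcb i x₀ a).2
  -- For fixed `a`, the points `G a z` with `z ∈ B a` lie on the boundary, where the transported
  -- partition sums to 1. What remains is `χ a`, and local Stokes applies.
  have h2 : ∀ a ∈ t, ∑ i, ∑ x₀ ∈ s, -∫ z in B a, q i x₀ a (G a z) * boundaryDensity oW η a z =
      chartIntegral oW (η.dWedge (χ a)) a := by
    intro a _
    rw [chartIntegral_dWedge_eq (χ := χ a) oW hη hη' (χ a).2 (isCompact_tsupport_chartPartition a)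
      (tsupport_chartPartition_subset a)]
    simp only [Finset.sum_neg_distrib]
    rw [← Finset.sum_congr rfl fun i _ => integral_finsetSum s fun x₀ _ => (hcb i x₀ a).1,
      ← integral_finsetSum _ fun i _ => integrable_finsetSum _ fun x₀ _ => (hcb i x₀ a).1]
    congr 1
    refine setIntegral_congr_fun (measurableSet_hyperplane_target a) fun z hz => ?_
    have hw : G a z ∈ ⋃ i, range (j i) := by
      rw [h.iUnion_range, mem_boundary_iff_extChartAt_zero
        ((extChartAt (𝓡∂ (k + 1)) a).map_target hz), (extChartAt (𝓡∂ (k + 1)) a).right_inv hz]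
      rfl
    have h3 := sum_extend_eq_one hinj h.disjoint hs1 hw
    simp only [q, mul_assoc, ← Finset.sum_mul]
    change (∑ i, ∑ x₀ ∈ s, Function.extend (j i) (ρ x₀) 0 (G a z)) * _ = _
    rw [h3, one_mul]
  simp only [h1]
  rw [Finset.sum_comm, Finset.sum_congr rfl h2]
  refine sum_chartIntegral_eq_zero oW ht1 (fun a _ => hη.dWedge (χ a).2)
    (fun a x hx => DiffForm.dWedge_eq_zero η hx)
    (DiffForm.sum_dWedge_eq_zero t (fun a _ => (χ a).2.mdifferentiable (by simp)) ht1 η)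

/-- On the target of a chart the coordinate frame is a basis, and for a basis the sign really
changes with the orientation; for other families it would be `-1` both times. -/
theorem integralForm_neg {m : ℕ} {H : Type*} [TopologicalSpace H]
    {I : ModelWithCorners ℝ (EuclideanSpace ℝ (Fin m)) H}
    {N : Type*} [TopologicalSpace N] [ChartedSpace H N] [IsManifold I 1 N] [IsManifold I ∞ N]
    [T2Space N] [CompactSpace N]
    (o : ManifoldOrientation I N) (α : DiffForm I N m) :
    integralForm (-o) α = -integralForm o α := by
  rw [integralForm, integralForm, ← finsum_neg_distrib]
  refine finsum_congr fun x₀ => ?_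
  rw [← integral_neg]
  refine setIntegral_congr_fun (measurableSet_extChartAt_target x₀) fun y hy => ?_
  obtain ⟨b, hb⟩ := exists_basis_eq_chartFrame (I := I) hy
  have h : frameSign ((-o).toFun ((extChartAt I x₀).symm y)) b =
    -frameSign (o.toFun ((extChartAt I x₀).symm y)) b := frameSign_neg_basis _ b
  simp only [orientedValue_eq_frameSign_mul, ← hb, h]
  ring

theorem pullback_comp {E : Type*} [NormedAddCommGroup E] [NormedSpace ℝ E]
    {H : Type*} [TopologicalSpace H] {I : ModelWithCorners ℝ E H}
    {E' : Type*} [NormedAddCommGroup E'] [NormedSpace ℝ E']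
    {H' : Type*} [TopologicalSpace H'] {J : ModelWithCorners ℝ E' H'}
    {E'' : Type*} [NormedAddCommGroup E''] [NormedSpace ℝ E'']
    {H'' : Type*} [TopologicalSpace H''] {K : ModelWithCorners ℝ E'' H''}
    {M : Type*} [TopologicalSpace M] [ChartedSpace H M]
    {W : Type*} [TopologicalSpace W] [ChartedSpace H' W]
    {N : Type*} [TopologicalSpace N] [ChartedSpace H'' N] {k : ℕ}
    (α : DiffForm I M k) {g : W → M} {f : N → W} (hg : MDifferentiable J I g)
    (hf : MDifferentiable K J f) :
    (α.pullback (g ∘ f) : DiffForm K N k) = (α.pullback g : DiffForm J W k).pullback f := by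
  funext x
  simp only [DiffForm.pullback]
  rw [mfderiv_comp x (hg (f x)) (hf x)]
  rfl

end Stokes

/-! ### Conservation of magnetic charge. -/

theorem mainTheorem2 {n k : ℕ} {M : Type*} [TopologicalSpace M]
    [ChartedSpace (EuclideanSpace ℝ (Fin n)) M] [IsManifold (𝓡 n) ∞ M]
    (F : DiffForm (𝓡 n) M k) (hF : F.IsClosed)
    {W : Type*} [TopologicalSpace W] [ChartedSpace (EuclideanHalfSpace (k + 1)) W]
    [IsManifold (𝓡∂ (k + 1)) ∞ W] [T2Space W] [CompactSpace W]
    (oW : ManifoldOrientation (𝓡∂ (k + 1)) W)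
    (g : W → M) (hg : Manifold.IsImmersion (𝓡∂ (k + 1)) (𝓡 n) ∞ g) :
    (∀ (f : StdSphere k → M) (o : ManifoldOrientation (𝓡 k) (StdSphere k)) (j : StdSphere k → W),
      Manifold.IsImmersion (𝓡 k) (𝓡 n) ∞ f →
      IsOrientedBoundary oW (fun _ : Unit => o) (fun _ => j) →
      f = g ∘ j →
      magneticCharge F o f = 0) ∧
    (∀ (f f' : StdSphere k → M) (o o' : ManifoldOrientation (𝓡 k) (StdSphere k))
      (j j' : StdSphere k → W),
      Manifold.IsImmersion (𝓡 k) (𝓡 n) ∞ f →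
      Manifold.IsImmersion (𝓡 k) (𝓡 n) ∞ f' →
      IsOrientedBoundary oW ![o, -o'] ![j, j'] →
      f = g ∘ j →
      f' = g ∘ j' →
      magneticCharge F o f = magneticCharge F o' f') := by
  have hgs := hg.contMDiff
  have hc : (F.pullback g : DiffForm (𝓡∂ (k + 1)) W k).IsContinuous := hF.isContinuous.pullback hgs
  have hcl : (F.pullback g : DiffForm (𝓡∂ (k + 1)) W k).IsClosedInterior :=
    hF.isClosedInterior_pullback hgs
  have hcomp : ∀ j : StdSphere k → W, Manifold.IsSmoothEmbedding (𝓡 k) (𝓡∂ (k + 1)) ∞ j →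
      (F.pullback (g ∘ j) : DiffForm (𝓡 k) (StdSphere k) k) =
        (F.pullback g : DiffForm (𝓡∂ (k + 1)) W k).pullback j := fun j hj =>
    pullback_comp F (hgs.mdifferentiable (by simp)) (hj.contMDiff.mdifferentiable (by simp))
  constructor
  · rintro f o j - hj rfl
    have h := sum_integralForm_boundary_eq_zero hj hc hcl
    rw [Fintype.sum_unique] at h
    rw [magneticCharge, hcomp j (hj.isSmoothEmbedding ())]
    exact h
  · rintro f f' o o' j j' - - hj rfl rfl
    have h := sum_integralForm_boundary_eq_zero hj hc hcl
    rw [Fin.sum_univ_two] at h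
    have h' : integralForm o ((F.pullback g : DiffForm (𝓡∂ (k + 1)) W k).pullback j) +
      integralForm (-o') ((F.pullback g : DiffForm (𝓡∂ (k + 1)) W k).pullback j') = 0 := h
    rw [integralForm_neg] at h'
    rw [magneticCharge, magneticCharge, hcomp j (hj.isSmoothEmbedding 0),
      hcomp j' (hj.isSmoothEmbedding 1)]
    linarith
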